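/- Let $n\ge 1$, and let $\Delta_n\times\Delta_{n-1}$ have the vertices $(\mathbf e_i,\mathbf e_j)$, $i\in[n+1]$, $j\in[n]$. We identify $(\mathbf e_i,\mathbf e_j)$ with the edge $(i,j)$ of the complete bipartite graph $K_{n+1,n}$ and with the square in column $i$ and row $j$ of the $(n+1)\times n$ grid. For $1\le a\le b\le n$, a Dyck path from $(a,a)$ to $(b,b)$ is the set of squares of a path from $(a,a)$ to $(b,b)$ with steps $(1,0)$ and $(0,1)$ such that $i\le j$ for all its squares $(i,j)$. An extended Dyck path is a set of squares of the form $\bigcup_{k=1}^r \big(D_k\cup\{(n+1,b_k)\}\big)$, where $0=b_0<b_1<\dots<b_r=n$ and $D_k$ is a Dyck path from $(b_{k-1}+1,b_{k-1}+1)$ to $(b_k,b_k)$. For $\ell\in[n]$ let the shift by $\ell$ send $(i,j)$ to $(i+\ell,j+\ell)$ if $i\le n$ and $(n+1,j)$ to $(n+1,j+\ell)$, with sums taken modulo $n$ in $[n]$. Let $\mathcal D_n$ be the set of all shifts of extended Dyck paths. Let $\mathcal M_n^{\mathrm{ext}}$ be the set of all shifts of those nonempty matchings $M$ in $K_{n+1,n}$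 that satisfy: $i<i'\Rightarrow j<j'$ for all $(i,j),(i',j')\in M$, and $i\le j$ for all $(i,j)\in M$ with $i\ne n+1$. A matching ensemble on $K_{n+1,n}$ is a family $\mathcal M$ of nonempty matchings such that: (supports) for all nonempty $I\subseteq[n+1]$, $J\subseteq[n]$ with $|I|=|J|$, exactly one $M\in\mathcal M$ is a perfect matching on the subgraph induced by $I$ and $J$; (closure) every nonempty subset of a member of $\mathcal M$ is in $\mathcal M$; (linkage) for every $M\in\mathcal M$ and every vertex $v$ of $K_{n+1,n}$ not covered by $M$, there are an edge $e'$ containing $v$ and an edge $e\in M$ that share a vertex such that $(M\setminus\{e\})\cup\{e'\}\in\mathcal M$. For a real function $h_{ij}$ on the vertices of $\Delta_n\times\Delta_{n-1}$, the regular subdivision induced by $h$ has as cells the nonempty vertex sets $F$ for which some affine function $\varphi$ satisfies $\varphi(\mathbf e_i,\mathbf e_j)\le h_{ij}$ for all $(i,j)$, with equality exactly on $F$. A triangulation is regular if it is induced by some $h$, that is, if its maximal simplices are the maximal cells of the regular subdivision induced by $h$. Then: 1. $\mathcal D_n$ is the set of maximal simplices of a triangulation of $\Delta_n\times\Delta_{n-1}$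 (using only vertices of the product), and this triangulation is regular. 2. $\mathcal M_n^{\mathrm{ext}}$ is a matching ensemble, and it is the family of all nonempty matchings contained in simplices of $\mathcal D_n$. 3. There is a constant $c_0\ge 1$ (depending only on $n$) such that for every real $c>c_0$ the triangulation is induced by the height function $$h_{ij}=\begin{cases}c^{\,j-i}&\text{if } i\le n \text{ and } j\ge i,\\ c^{\,n+j-i}&\text{if } j<i\le n,\\ 1&\text{if } i=n+1.\end{cases}$$ -/

import Mathlib

/-!
Throughout, the index sets `[m]` and `[n]` are `Fin m` and `Fin n` (so labels start at `0`), and an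
element `(i, j)` of `Fin m × Fin n` is at the same time the vertex `(e_i, e_j)` of the product
`Δ_{m-1} × Δ_{n-1}`, the edge `(i, j)` of the complete bipartite graph `K_{m,n}`, and the square in
column `i` and row `j` of the `m × n` grid.  In `Fin (n + 1)` the last element `Fin.last n` plays
the role of the distinguished label `n + 1`.
-/

namespace DyckTri

/-! ### Triangulations and regular subdivisions of a product of two simplices -/

/-- The vertex `(e_i, e_j)` of `Δ_{m-1} × Δ_{n-1}`, in its standard realization. -/
def vertexPoint {m n : ℕ} (p : Fin m × Fin n) : (Fin m → ℝ) × (Fin n → ℝ) :=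
  (Pi.single p.1 1, Pi.single p.2 1)

/-- `T` is the set of maximal simplices (given by their vertex labels) of a triangulation of
`Δ_{m-1} × Δ_{n-1}`: there is a geometric simplicial complex that covers exactly the product, uses
only vertices of the product, and has the simplices in `T` as its facets. -/
def IsTriangulation {m n : ℕ} (T : Set (Finset (Fin m × Fin n))) : Prop :=
  ∃ K : Geometry.SimplicialComplex ℝ ((Fin m → ℝ) × (Fin n → ℝ)),
    K.space = stdSimplex ℝ (Fin m) ×ˢ stdSimplex ℝ (Fin n) ∧
    K.vertices ⊆ Set.range vertexPoint ∧
    K.facets = {f : Finset ((Fin m → ℝ) × (Fin n → ℝ)) | ∃ s ∈ T,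
      (f : Set ((Fin m → ℝ) × (Fin n → ℝ))) = vertexPoint '' (s : Set (Fin m × Fin n))}

/-- The cells of the regular subdivision of `Δ_{m-1} × Δ_{n-1}` induced by the height function `h`.
A cell is a nonempty set of vertices over which some affine function, lying weakly below all the
heights, meets the heights exactly; these are the lower faces of the lifted configuration. -/
def regularCells {m n : ℕ} (h : Fin m → Fin n → ℝ) : Set (Finset (Fin m × Fin n)) :=
  {F | F.Nonempty ∧ ∃ φ : ((Fin m → ℝ) × (Fin n → ℝ)) →ᵃ[ℝ] ℝ, ∀ p : Fin m × Fin n,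
    φ (vertexPoint p) ≤ h p.1 p.2 ∧ (φ (vertexPoint p) = h p.1 p.2 ↔ p ∈ F)}

/-- `T` is the set of maximal cells of the regular subdivision induced by the heights `h`. -/
def IsInducedBy {m n : ℕ} (T : Set (Finset (Fin m × Fin n))) (h : Fin m → Fin n → ℝ) : Prop :=
  T = {F | Maximal (fun G => G ∈ regularCells h) F}

/-- A triangulation is regular if it is induced by some height function. -/
def IsRegularTriangulation {m n : ℕ} (T : Set (Finset (Fin m × Fin n))) : Prop :=
  IsTriangulation T ∧ ∃ h : Fin m → Fin n → ℝ, IsInducedBy T h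

/-! ### Matching ensembles -/

/-- A set of edges is a matching if no two different edges share a vertex.  A matching `M` is a
perfect matching on the subgraph induced by `M.image Prod.fst` and `M.image Prod.snd`. -/
def IsMatching {m n : ℕ} (M : Finset (Fin m × Fin n)) : Prop :=
  ∀ p ∈ M, ∀ q ∈ M, (p.1 = q.1 ∨ p.2 = q.2) → p = q

/-- Matching ensembles on `K_{m,n}`: families of (nonempty) matchings satisfying the supports axiom,
the closure axiom, and the linkage axiom (stated for a vertex of either side). -/
structure IsMatchingEnsemble {m n : ℕ} (𝓜 : Set (Finset (Fin m × Fin n))) : Prop where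
  matching : ∀ M ∈ 𝓜, M.Nonempty ∧ IsMatching M
  supports : ∀ (I : Finset (Fin m)) (J : Finset (Fin n)), I.Nonempty → I.card = J.card →
    ∃! M, M ∈ 𝓜 ∧ M.image Prod.fst = I ∧ M.image Prod.snd = J
  closure : ∀ M ∈ 𝓜, ∀ M' ⊆ M, M'.Nonempty → M' ∈ 𝓜
  linkage_left : ∀ M ∈ 𝓜, ∀ i : Fin m, i ∉ M.image Prod.fst →
    ∃ e ∈ M, ∃ e' : Fin m × Fin n, e'.1 = i ∧ (e'.1 = e.1 ∨ e'.2 = e.2) ∧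
      insert e' (M.erase e) ∈ 𝓜
  linkage_right : ∀ M ∈ 𝓜, ∀ j : Fin n, j ∉ M.image Prod.snd →
    ∃ e ∈ M, ∃ e' : Fin m × Fin n, e'.2 = j ∧ (e'.1 = e.1 ∨ e'.2 = e.2) ∧
      insert e' (M.erase e) ∈ 𝓜

/-- The family of all (nonempty) matchings contained in the simplices of `T`. -/
def matchingsOf {m n : ℕ} (T : Set (Finset (Fin m × Fin n))) : Set (Finset (Fin m × Fin n)) :=
  {M | M.Nonempty ∧ IsMatching M ∧ ∃ s ∈ T, M ⊆ s}

/-! ### Extended Dyck paths -/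

/-- One step of a monotone path in the grid: one square to the right or one square up. -/
def GridStep {m n : ℕ} (p q : Fin m × Fin n) : Prop :=
  (q.1.val = p.1.val + 1 ∧ q.2 = p.2) ∨ (q.1 = p.1 ∧ q.2.val = p.2.val + 1)

/-- `D` is the set of squares of a Dyck path from the diagonal square `(a, a)` to the diagonal
square `(b, b)`: a monotone path all of whose squares `(i, j)` satisfy `i ≤ j`. -/
def IsDyckPath {n : ℕ} (a b : Fin n) (D : Finset (Fin (n + 1) × Fin n)) : Prop :=
  ∃ l : List (Fin (n + 1) × Fin n),
    l.head? = some (a.castSucc, a) ∧ l.getLast? = some (b.castSucc, b) ∧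
    l.IsChain GridStep ∧ (∀ p ∈ l, p.1.val ≤ p.2.val) ∧ D = l.toFinset

/-- `IsExtDyckFrom a s`: the set `s` consists of Dyck paths concatenated one after the other, the
first one starting at `(a, a)`, each next one starting at the diagonal square following the last
square of the previous one, and the final one ending in the last row, together with the square in
the last column (`Fin.last n`) and last row of each of these Dyck paths. -/
inductive IsExtDyckFrom {n : ℕ} : ℕ → Finset (Fin (n + 1) × Fin n) → Prop
  | nil : IsExtDyckFrom n ∅
  | cons (a b : Fin n) (D s : Finset (Fin (n + 1) × Fin n)) :
      IsDyckPath a b D → IsExtDyckFrom (b.val + 1) s →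
      IsExtDyckFrom a.val (insert (Fin.last n, b) (D ∪ s))

/-- Extended Dyck paths in the `(n + 1) × n` grid. -/
def IsExtDyckPath {n : ℕ} (s : Finset (Fin (n + 1) × Fin n)) : Prop :=
  IsExtDyckFrom 0 s

/-- The map on `Fin (n + 1)` that shifts the first `n` labels cyclically by `ℓ` and fixes the last
one. -/
def shiftFst {n : ℕ} [NeZero n] (ℓ : Fin n) (i : Fin (n + 1)) : Fin (n + 1) :=
  Fin.lastCases (motive := fun _ => Fin (n + 1)) (Fin.last n) (fun k => (k + ℓ).castSucc) i

/-- The simultaneous cyclic shift by `ℓ` (addition in `Fin n` is modulo `n`). -/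
def shift {n : ℕ} [NeZero n] (ℓ : Fin n) (p : Fin (n + 1) × Fin n) : Fin (n + 1) × Fin n :=
  (shiftFst ℓ p.1, p.2 + ℓ)

/-- The maximal simplices of the extended Dyck path triangulation: the extended Dyck paths and all
their cyclic shifts. -/
def extDyckTriangulation (n : ℕ) [NeZero n] : Set (Finset (Fin (n + 1) × Fin n)) :=
  {t | ∃ (ℓ : Fin n) (s : Finset (Fin (n + 1) × Fin n)), IsExtDyckPath s ∧ t = s.image (shift ℓ)}

/-! ### The matching ensemble and the height function -/

/-- Non-crossing and, away from the last vertex of the first part, weakly increasing. -/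
def IsNonCrossingIncreasing {n : ℕ} (M : Finset (Fin (n + 1) × Fin n)) : Prop :=
  (∀ p ∈ M, ∀ q ∈ M, p.1 < q.1 → p.2 < q.2) ∧ ∀ p ∈ M, p.1 ≠ Fin.last n → p.1.val ≤ p.2.val

/-- The family of all cyclic shifts of (nonempty) non-crossing, weakly increasing matchings. -/
def extDyckMatchings (n : ℕ) [NeZero n] : Set (Finset (Fin (n + 1) × Fin n)) :=
  {M' | ∃ (ℓ : Fin n) (M : Finset (Fin (n + 1) × Fin n)), M.Nonempty ∧ IsMatching M ∧
    IsNonCrossingIncreasing M ∧ M' = M.image (shift ℓ)}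

/-- The height of `(e_i, e_j)`: `1` if `i` is the last label, otherwise `c ^ (j - i)` if `i ≤ j`,
and `c ^ (n + j - i)` if `j < i`. -/
def dyckHeight (n : ℕ) (c : ℝ) (i : Fin (n + 1)) (j : Fin n) : ℝ :=
  if i = Fin.last n then 1
  else if i.val ≤ j.val then c ^ (j.val - i.val)
  else c ^ (n + j.val - i.val)

end DyckTri

/-! A vertex set `s` is read as a bipartite graph, and a point `(y, z)` of the product as a
transport problem with supplies `y` and demands `z`. Barycentric coordinates of the point on `s` are
then exactly a transport plan supported on `s`.

The general claims follow from `IsTightFamily`: every transport problem is solved on some member,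
every member is the exact contact set of a dual potential `u + v` with the heights, and every member
is a spanning tree. Complementary slackness (`IsTightOn.transfer`) and uniqueness of plans on a
forest give one plan per problem across the whole family. So simplices meet in common faces, every
cell of the regular subdivision lies in a member, and a matching, being a 0/1 plan, is determined by
its two vertex sets. Hall's theorem extracts matchings from nearly doubly stochastic plans, and
moving one unit of supply or demand yields linkage.

Extended Dyck paths are handled square by square through `PathTail`. For covering, the cycle lemma
rotates a problem until its suffix surpluses are nonpositive, and the north-west corner rule then
traces an extended Dyck path. For tightness, a potential is built backwards along the path; strict
convexity of `k ↦ c ^ k` makes every `c > 1` work. The heights depend only on cyclic differences, so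
the shifts come for free. -/

namespace DyckTri

/-! ### Transport plans and potentials -/

section Plans

variable {m n : ℕ}

/-- `w` is a nonnegative matrix with row sums `y` and column sums `z` that vanishes outside `s`. -/
structure IsPlanOn (s : Finset (Fin m × Fin n)) (y : Fin m → ℝ) (z : Fin n → ℝ)
    (w : Fin m × Fin n → ℝ) : Prop where
  nonneg : ∀ p, 0 ≤ w p
  supp : ∀ p, p ∉ s → w p = 0
  fst : ∀ i, ∑ j, w (i, j) = y i
  snd : ∀ j, ∑ i, w (i, j) = z j

variable {s t : Finset (Fin m × Fin n)} {y : Fin m → ℝ} {z : Fin n → ℝ}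
  {w w' : Fin m × Fin n → ℝ}

lemma IsPlanOn.mono (hw : IsPlanOn s y z w) (hst : s ⊆ t) : IsPlanOn t y z w :=
  ⟨hw.nonneg, fun p hp => hw.supp p fun h => hp (hst h), hw.fst, hw.snd⟩

lemma IsPlanOn.mem_of_pos (hw : IsPlanOn s y z w) {p : Fin m × Fin n} (hp : 0 < w p) : p ∈ s := by
  by_contra h
  exact hp.ne' (hw.supp p h)

lemma IsPlanOn.le_fst (hw : IsPlanOn s y z w) (p : Fin m × Fin n) : w p ≤ y p.1 := by
  rw [← hw.fst]
  exact Finset.single_le_sum (f := fun j => w (p.1, j)) (fun j _ => hw.nonneg _)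
    (Finset.mem_univ p.2)

lemma IsPlanOn.le_snd (hw : IsPlanOn s y z w) (p : Fin m × Fin n) : w p ≤ z p.2 := by
  rw [← hw.snd]
  exact Finset.single_le_sum (f := fun i => w (i, p.2)) (fun j _ => hw.nonneg _)
    (Finset.mem_univ p.1)

lemma IsPlanOn.sum_mul (hw : IsPlanOn s y z w) (u : Fin m → ℝ) (v : Fin n → ℝ) :
    ∑ p, w p * (u p.1 + v p.2) = ∑ i, y i * u i + ∑ j, z j * v j := by
  simp_rw [mul_add, Finset.sum_add_distrib, ← hw.fst, ← hw.snd, Finset.sum_mul]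
  congr 1
  · rw [Fintype.sum_prod_type]
  · rw [Fintype.sum_prod_type_right]

/-- The potential `u + v` lies below `h` and agrees with it exactly on `s`. -/
def IsTightOn (h : Fin m → Fin n → ℝ) (s : Finset (Fin m × Fin n)) (u : Fin m → ℝ)
    (v : Fin n → ℝ) : Prop :=
  ∀ i j, u i + v j ≤ h i j ∧ (u i + v j = h i j ↔ (i, j) ∈ s)

lemma IsTightOn.cost_eq {h : Fin m → Fin n → ℝ} {u : Fin m → ℝ} {v : Fin n → ℝ}
    (hs : IsTightOn h s u v) (hw : IsPlanOn s y z w) :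
    ∑ p, w p * h p.1 p.2 = ∑ p, w p * (u p.1 + v p.2) := by
  refine Finset.sum_congr rfl fun p _ => ?_
  by_cases hp : p ∈ s
  · rw [(hs p.1 p.2).2.2 hp]
  · simp [hw.supp p hp]

/-- Complementary slackness: a plan on one tight set is supported on every other tight set that
carries a plan with the same marginals. -/
lemma IsTightOn.transfer {h : Fin m → Fin n → ℝ} {u u' : Fin m → ℝ} {v v' : Fin n → ℝ}
    (hs : IsTightOn h s u v) (ht : IsTightOn h t u' v') (hw : IsPlanOn s y z w)
    (hw' : IsPlanOn t y z w') : IsPlanOn s y z w' := by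
  have e1 := hs.cost_eq hw
  have e2 := ht.cost_eq hw'
  have e3 : ∑ p, w p * (u' p.1 + v' p.2) ≤ ∑ p, w p * h p.1 p.2 :=
    Finset.sum_le_sum fun p _ => mul_le_mul_of_nonneg_left (ht p.1 p.2).1 (hw.nonneg p)
  rw [hw.sum_mul] at e1 e3
  rw [hw'.sum_mul] at e2
  have e4 : ∑ p, w' p * (h p.1 p.2 - (u p.1 + v p.2)) ≤ 0 := by
    simp_rw [mul_sub, Finset.sum_sub_distrib]
    rw [hw'.sum_mul]
    linarith
  have nn : ∀ p ∈ Finset.univ, 0 ≤ w' p * (h p.1 p.2 - (u p.1 + v p.2)) := fun p _ =>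
    mul_nonneg (hw'.nonneg p) (sub_nonneg.2 (hs p.1 p.2).1)
  have e5 := (Finset.sum_eq_zero_iff_of_nonneg nn).1 (le_antisymm e4 (Finset.sum_nonneg nn))
  refine ⟨hw'.nonneg, fun p hp => ?_, hw'.fst, hw'.snd⟩
  rcases mul_eq_zero.1 (e5 p (Finset.mem_univ p)) with h0 | h0
  · exact h0
  · exact absurd ((hs p.1 p.2).2.1 (by linarith)) hp

/-- Every function on `s` is the restriction of some potential. -/
def IsSolvable (s : Finset (Fin m × Fin n)) : Prop :=
  ∀ g : Fin m × Fin n → ℝ, ∃ (u : Fin m → ℝ) (v : Fin n → ℝ), ∀ p ∈ s, u p.1 + v p.2 = g p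

/-- Pairing `d` with a potential that agrees with `d` on `s` gives the sum of the squares of `d`,
while vanishing marginals make this pairing zero. -/
lemma IsSolvable.eq_zero (hs : IsSolvable s) {d : Fin m × Fin n → ℝ} (hd : ∀ p, p ∉ s → d p = 0)
    (h1 : ∀ i, ∑ j, d (i, j) = 0) (h2 : ∀ j, ∑ i, d (i, j) = 0) : d = 0 := by
  obtain ⟨u, v, huv⟩ := hs d
  have e : ∑ p, d p * (u p.1 + v p.2) = 0 := by
    simp_rw [mul_add, Finset.sum_add_distrib]
    rw [Fintype.sum_prod_type, Fintype.sum_prod_type_right (f := fun p => d p * v p.2)]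
    simp [← Finset.sum_mul, h1, h2]
  have e' : ∑ p, d p * d p = 0 := by
    rw [← e]
    refine Finset.sum_congr rfl fun p _ => ?_
    by_cases hp : p ∈ s
    · rw [huv p hp]
    · simp [hd p hp]
  funext p
  simpa using (Finset.sum_eq_zero_iff_of_nonneg (fun p _ => mul_self_nonneg (d p))).1 e' p
    (Finset.mem_univ p)

lemma IsSolvable.plan_unique (hs : IsSolvable s) (hw : IsPlanOn s y z w)
    (hw' : IsPlanOn s y z w') : w = w' :=
  sub_eq_zero.1 <| hs.eq_zero (d := w - w') (fun p hp => by simp [hw.supp p hp, hw'.supp p hp])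
    (fun i => by simp [hw.fst, hw'.fst]) (fun j => by simp [hw.snd, hw'.snd])

/-! ### Geometry of the vertices -/

lemma vertexPoint_injective : Function.Injective (vertexPoint (m := m) (n := n)) := by
  rintro ⟨i, j⟩ ⟨i', j'⟩ h
  simp only [vertexPoint, Prod.mk.injEq] at h
  have h1 := congrFun h.1 i
  have h2 := congrFun h.2 j
  simp only [Pi.single_apply] at h1 h2
  ext <;> grind

lemma sum_smul_vertexPoint (w : Fin m × Fin n → ℝ) :
    ∑ p, w p • vertexPoint p = (fun i => ∑ j, w (i, j), fun j => ∑ i, w (i, j)) := by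
  ext k
  · simp [vertexPoint, Prod.fst_sum, Finset.sum_apply, Fintype.sum_prod_type, Pi.single_apply]
  · simp [vertexPoint, Prod.snd_sum, Finset.sum_apply, Fintype.sum_prod_type_right,
      Pi.single_apply]

lemma IsPlanOn.sum_eq (hw : IsPlanOn s y z w) : ∑ p, w p = ∑ i, y i := by
  rw [Fintype.sum_prod_type]
  exact Finset.sum_congr rfl fun i _ => hw.fst i

/-- The weights of a convex combination form the plan. One normalization suffices, because row sums
and column sums have the same total. -/
lemma mem_convexHull_image_vertexPoint {x : (Fin m → ℝ) × (Fin n → ℝ)} :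
    x ∈ convexHull ℝ ((s.image vertexPoint : Finset _) : Set ((Fin m → ℝ) × (Fin n → ℝ))) ↔
      ∑ i, x.1 i = 1 ∧ ∃ w, IsPlanOn s x.1 x.2 w := by
  rw [Finset.mem_convexHull']
  simp_rw [Finset.sum_image vertexPoint_injective.injOn, Finset.forall_mem_image]
  constructor
  · rintro ⟨W, h0, h1, h2⟩
    have key : ∑ p, (if p ∈ s then W (vertexPoint p) else 0) • vertexPoint p = x := by
      simpa [ite_smul] using h2
    have hw : IsPlanOn s x.1 x.2 fun p => if p ∈ s then W (vertexPoint p) else 0 := by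
      rw [sum_smul_vertexPoint] at key
      refine ⟨fun p => ?_, fun p hp => by simp [hp], fun i => ?_, fun j => ?_⟩
      · by_cases hp : p ∈ s
        · simpa [hp] using h0 hp
        · simp [hp]
      · rw [← key]
      · rw [← key]
    refine ⟨?_, _, hw⟩
    rw [← hw.sum_eq]
    simpa using h1
  · rintro ⟨h1, w, hw⟩
    have hext : ∀ p, Function.extend vertexPoint w 0 (vertexPoint p) = w p := fun p =>
      vertexPoint_injective.extend_apply _ _ _
    refine ⟨Function.extend vertexPoint w 0, fun p _ => ?_, ?_, ?_⟩
    · rw [hext]; exact hw.nonneg p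
    · simp_rw [hext]
      rw [← h1, ← hw.sum_eq]
      exact Finset.sum_subset (Finset.subset_univ _) fun p _ hp => hw.supp p hp
    · simp_rw [hext]
      rw [Finset.sum_subset (Finset.subset_univ s) fun p _ hp => by rw [hw.supp p hp, zero_smul],
        sum_smul_vertexPoint]
      ext k
      · exact hw.fst k
      · exact hw.snd k

/-- The vertices are even linearly independent: the coefficients of a linear relation form a matrix
on `s` with zero marginals. -/
lemma IsSolvable.affineIndependent (hs : IsSolvable s) :
    AffineIndependent ℝ ((↑) : ↥(s.image vertexPoint) → (Fin m → ℝ) × (Fin n → ℝ)) := by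
  have hl : LinearIndependent ℝ fun p : s => vertexPoint (p : Fin m × Fin n) := by
    rw [Fintype.linearIndependent_iff]
    intro g hg
    set d : Fin m × Fin n → ℝ := fun p => if hp : p ∈ s then g ⟨p, hp⟩ else 0 with hd
    have e : ∑ p, d p • vertexPoint p = 0 := by
      rw [← hg, ← Finset.sum_subset (Finset.subset_univ s) fun p _ hp => by simp [hd, hp],
        ← Finset.sum_coe_sort]
      exact Finset.sum_congr rfl fun p _ => by simp [hd]
    rw [sum_smul_vertexPoint, Prod.ext_iff] at e
    have h0 := hs.eq_zero (d := d) (fun p hp => by simp [hd, hp]) (congrFun e.1) (congrFun e.2)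
    intro p
    have := congrFun h0 p
    simpa [hd] using this
  have ha := hl.affineIndependent.range
  refine ha.mono ?_
  intro x hx
  obtain ⟨p, hp, rfl⟩ := Finset.mem_image.1 (Finset.mem_coe.1 hx)
  exact ⟨⟨p, hp⟩, rfl⟩

lemma exists_potential_of_affineMap (φ : ((Fin m → ℝ) × (Fin n → ℝ)) →ᵃ[ℝ] ℝ) :
    ∃ (u : Fin m → ℝ) (v : Fin n → ℝ), ∀ p, φ (vertexPoint p) = u p.1 + v p.2 := by
  refine ⟨fun i => φ.linear (Pi.single i 1, 0) + φ 0, fun j => φ.linear (0, Pi.single j 1),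
    fun p => ?_⟩
  have h := φ.map_vadd 0 (vertexPoint p)
  simp only [vadd_eq_add, add_zero] at h
  rw [h, add_right_comm, ← map_add]
  simp [vertexPoint]

lemma exists_affineMap_of_potential (u : Fin m → ℝ) (v : Fin n → ℝ) :
    ∃ φ : ((Fin m → ℝ) × (Fin n → ℝ)) →ᵃ[ℝ] ℝ, ∀ p, φ (vertexPoint p) = u p.1 + v p.2 := by
  refine ⟨(((Fintype.linearCombination ℝ u).coprod
    (Fintype.linearCombination ℝ v)) : _ →ₗ[ℝ] ℝ).toAffineMap, fun p => ?_⟩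
  simp [vertexPoint, Fintype.linearCombination_apply, Pi.single_apply]

lemma mem_regularCells_iff {h : Fin m → Fin n → ℝ} :
    s ∈ regularCells h ↔ s.Nonempty ∧ ∃ u v, IsTightOn h s u v := by
  refine and_congr_right fun _ => ⟨?_, ?_⟩
  · rintro ⟨φ, hφ⟩
    obtain ⟨u, v, huv⟩ := exists_potential_of_affineMap φ
    exact ⟨u, v, fun i j => by simpa [huv] using hφ (i, j)⟩
  · rintro ⟨u, v, huv⟩
    obtain ⟨φ, hφ⟩ := exists_affineMap_of_potential u v
    exact ⟨φ, fun p => by simpa [hφ] using huv p.1 p.2⟩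

end Plans

/-! ### Families of trees covering all transport problems -/

/-- A family of spanning trees of `K_{m,n}` that solve every transport problem and are tight
for the heights `h`. -/
structure IsTightFamily {m n : ℕ} (T : Set (Finset (Fin m × Fin n)))
    (h : Fin m → Fin n → ℝ) : Prop where
  nonempty : ∀ s ∈ T, s.Nonempty
  cover : ∀ (y : Fin m → ℝ) (z : Fin n → ℝ), (∀ i, 0 ≤ y i) → (∀ j, 0 ≤ z j) →
    ∑ i, y i = ∑ j, z j → ∃ s ∈ T, ∃ w, IsPlanOn s y z w
  tight : ∀ s ∈ T, ∃ u v, IsTightOn h s u v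
  solvable : ∀ s ∈ T, IsSolvable s
  spanning : ∀ s ∈ T, ∀ (u : Fin m → ℝ) (v : Fin n → ℝ), (∀ p ∈ s, u p.1 + v p.2 = 0) →
    ∀ i j, u i + v j = 0

namespace IsTightFamily

variable {m n : ℕ} {T : Set (Finset (Fin m × Fin n))} {h : Fin m → Fin n → ℝ}
  {s t : Finset (Fin m × Fin n)} {y : Fin m → ℝ} {z : Fin n → ℝ} {w w' : Fin m × Fin n → ℝ}

/-- If `t` had a further edge `p`, a potential equal to the indicator of `p` on `t` would vanish on
`s`, hence everywhere, including at `p`. -/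
lemma eq_of_subset (hT : IsTightFamily T h) (hs : s ∈ T) (ht : t ∈ T) (hst : s ⊆ t) : s = t := by
  refine hst.antisymm fun p hp => ?_
  by_contra hps
  obtain ⟨u, v, huv⟩ := hT.solvable t ht (Pi.single p 1)
  have := hT.spanning s hs u v (fun q hq => by
    rw [huv q (hst hq), Pi.single_apply, if_neg]
    rintro rfl
    exact hps hq) p.1 p.2
  rw [huv p hp] at this
  simp at this

lemma plan_unique (hT : IsTightFamily T h) (hs : s ∈ T) (ht : t ∈ T) (hw : IsPlanOn s y z w)
    (hw' : IsPlanOn t y z w') : w = w' := by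
  obtain ⟨u, v, huv⟩ := hT.tight s hs
  obtain ⟨u', v', huv'⟩ := hT.tight t ht
  exact (hT.solvable s hs).plan_unique hw (huv.transfer huv' hw hw')

/-- A point common to two simplices has the same plan in both, so its support lies in the
intersection of their vertex sets. Covering gives the space, and the absence of proper inclusions
gives the facets. -/
theorem isTriangulation (hT : IsTightFamily T h) : IsTriangulation T := by
  classical
  refine ⟨{
    faces := {f | ∃ s ∈ T, ∃ r ⊆ s, r.Nonempty ∧ f = r.image vertexPoint}
    isRelLowerSet_faces := ?_
    indep := ?_
    inter_subset_convexHull := ?_ }, ?_, ?_, ?_⟩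
  · rintro f ⟨s, hs, r, hr, hr0, rfl⟩
    refine ⟨hr0.image _, fun g hg hg0 => ?_⟩
    obtain ⟨r', hr', rfl⟩ := Finset.subset_image_iff.1 hg
    exact ⟨s, hs, r', hr'.trans hr, Finset.image_nonempty.1 hg0, rfl⟩
  · rintro f ⟨s, hs, r, hr, hr0, rfl⟩
    exact (hT.solvable s hs).affineIndependent.mono
      (Finset.coe_subset.2 (Finset.image_subset_image hr))
  · rintro f g ⟨s, hs, r, hr, hr0, rfl⟩ ⟨s', hs', r', hr', hr0', rfl⟩ x ⟨hx, hx'⟩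
    obtain ⟨h1, w, hw⟩ := mem_convexHull_image_vertexPoint.1 hx
    obtain ⟨-, w', hw'⟩ := mem_convexHull_image_vertexPoint.1 hx'
    have hww := hT.plan_unique hs hs' (hw.mono hr) (hw'.mono hr')
    subst hww
    rw [← Finset.coe_inter, ← Finset.image_inter _ _ vertexPoint_injective,
      mem_convexHull_image_vertexPoint]
    refine ⟨h1, w, hw.nonneg, fun p hp => ?_, hw.fst, hw.snd⟩
    by_contra h0
    exact hp (Finset.mem_inter.2 ⟨of_not_not fun h => h0 (hw.supp p h),
      of_not_not fun h => h0 (hw'.supp p h)⟩)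
  · ext x
    rw [Geometry.SimplicialComplex.mem_space_iff]
    constructor
    · rintro ⟨f, ⟨s, hs, r, hr, hr0, rfl⟩, hx⟩
      obtain ⟨h1, w, hw⟩ := mem_convexHull_image_vertexPoint.1 hx
      refine ⟨⟨fun i => ?_, h1⟩, fun j => ?_, ?_⟩
      · rw [← hw.fst]
        exact Finset.sum_nonneg fun _ _ => hw.nonneg _
      · rw [← hw.snd]
        exact Finset.sum_nonneg fun _ _ => hw.nonneg _
      · rw [← h1, ← hw.sum_eq, Fintype.sum_prod_type_right]
        exact Finset.sum_congr rfl fun j _ => (hw.snd j).symm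
    · rintro ⟨h1, h2⟩
      obtain ⟨s, hs, w, hw⟩ := hT.cover x.1 x.2 h1.1 h2.1 (h1.2.trans h2.2.symm)
      exact ⟨_, ⟨s, hs, s, subset_rfl, hT.nonempty s hs, rfl⟩,
        mem_convexHull_image_vertexPoint.2 ⟨h1.2, w, hw⟩⟩
  · rintro x ⟨s, hs, r, hr, hr0, hx⟩
    have : x ∈ r.image vertexPoint := hx ▸ Finset.mem_singleton_self x
    obtain ⟨p, -, hp⟩ := Finset.mem_image.1 this
    exact ⟨p, hp⟩
  · ext f
    rw [Geometry.SimplicialComplex.mem_facets]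
    constructor
    · rintro ⟨⟨s, hs, r, hr, hr0, rfl⟩, hmax⟩
      refine ⟨s, hs, ?_⟩
      rw [hmax (s.image vertexPoint) ⟨s, hs, s, subset_rfl, hT.nonempty s hs, rfl⟩
        (Finset.image_subset_image hr), Finset.coe_image]
    · rintro ⟨s, hs, hf⟩
      rw [← Finset.coe_image, Finset.coe_inj] at hf
      subst hf
      refine ⟨⟨s, hs, s, subset_rfl, hT.nonempty s hs, rfl⟩, ?_⟩
      rintro g ⟨t, ht, r, hr, hr0, rfl⟩ hst
      have hsr := (Finset.image_subset_image_iff vertexPoint_injective).1 hst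
      have := hT.eq_of_subset hs ht (hsr.trans hr)
      subst this
      rw [hsr.antisymm hr]

/-- It suffices that every cell lies in a member of `T`; maximality is then settled by the absence
of proper inclusions within `T`. -/
theorem isInducedBy (hT : IsTightFamily T h) : IsInducedBy T h := by
  have hcell : ∀ s ∈ T, s ∈ regularCells h := fun s hs =>
    mem_regularCells_iff.2 ⟨hT.nonempty s hs, hT.tight s hs⟩
  have hsub : ∀ F ∈ regularCells h, ∃ s ∈ T, F ⊆ s := by
    intro F hF
    obtain ⟨-, u, v, huv⟩ := mem_regularCells_iff.1 hF
    -- The indicator of `F` is a plan with full support on `F`. A member `s` carrying a plan with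
    -- the same marginals must, by complementary slackness, contain that support.
    set w : Fin m × Fin n → ℝ := fun p => if p ∈ F then 1 else 0 with hw_def
    have hw0 : ∀ p, 0 ≤ w p := fun p => by simp only [hw_def]; split_ifs <;> norm_num
    have hw : IsPlanOn F (fun i => ∑ j, w (i, j)) (fun j => ∑ i, w (i, j)) w :=
      ⟨hw0, fun p hp => by simp [hw_def, hp], fun _ => rfl, fun _ => rfl⟩
    obtain ⟨s, hs, w', hw'⟩ := hT.cover _ _ (fun i => Finset.sum_nonneg fun j _ => hw0 (i, j))
      (fun j => Finset.sum_nonneg fun i _ => hw0 (i, j)) Finset.sum_comm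
    obtain ⟨u', v', huv'⟩ := hT.tight s hs
    have := huv'.transfer huv hw' hw
    exact ⟨s, hs, fun p hp => this.mem_of_pos (by simp [hw_def, hp])⟩
  ext F
  constructor
  · refine fun hF => ⟨hcell F hF, fun G hG hFG => ?_⟩
    obtain ⟨s, hs, hGs⟩ := hsub G hG
    have := hT.eq_of_subset hF hs (hFG.trans hGs)
    subst this
    exact hGs
  · intro hF
    obtain ⟨s, hs, hFs⟩ := hsub F hF.1
    exact (hFs.antisymm (hF.2 (hcell s hs) hFs)) ▸ hs

end IsTightFamily

/-! ### Matchings in tight families -/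

section Matchings

variable {m n : ℕ}

lemma IsMatching.mono {M M' : Finset (Fin m × Fin n)} (hM : IsMatching M) (h : M' ⊆ M) :
    IsMatching M' :=
  fun p hp q hq => hM p (h hp) q (h hq)

lemma IsMatching.isPlanOn {M : Finset (Fin m × Fin n)} (hM : IsMatching M) :
    IsPlanOn M (fun i => if i ∈ M.image Prod.fst then 1 else 0)
      (fun j => if j ∈ M.image Prod.snd then 1 else 0) (fun p => if p ∈ M then 1 else 0) := by
  refine ⟨fun p => by split_ifs <;> norm_num, fun p hp => if_neg hp, fun i => ?_,
    fun j => ?_⟩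
  · split_ifs with h
    · obtain ⟨p, hp, rfl⟩ := Finset.mem_image.1 h
      rw [Finset.sum_eq_single p.2 (fun j _ hj => if_neg fun hj' => hj ?_) (by simp), if_pos hp]
      exact congrArg Prod.snd (hM _ hj' _ hp (Or.inl rfl))
    · exact Finset.sum_eq_zero fun j _ => if_neg fun hj => h (Finset.mem_image_of_mem Prod.fst hj)
  · split_ifs with h
    · obtain ⟨p, hp, rfl⟩ := Finset.mem_image.1 h
      rw [Finset.sum_eq_single p.1 (fun i _ hi => if_neg fun hi' => hi ?_) (by simp), if_pos hp]
      exact congrArg Prod.fst (hM _ hi' _ hp (Or.inr rfl))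
    · exact Finset.sum_eq_zero fun i _ => if_neg fun hi => h (Finset.mem_image_of_mem Prod.snd hi)

/-- A plan whose part between `I` and `J` is close to being doubly stochastic (up to the factor
`N`) has a perfect matching between `I` and `J` in its support. -/
lemma IsPlanOn.exists_matching {s : Finset (Fin m × Fin n)} {y : Fin m → ℝ} {z : Fin n → ℝ}
    {w : Fin m × Fin n → ℝ} (hw : IsPlanOn s y z w) {I : Finset (Fin m)} {J : Finset (Fin n)}
    (hIJ : I.card = J.card) {N : ℝ} (hN : (I.card : ℝ) < N)
    (hI : ∀ i ∈ I, N - 1 ≤ ∑ j ∈ J, w (i, j)) (hJ : ∀ j ∈ J, z j ≤ N) :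
    ∃ M ⊆ s, IsMatching M ∧ M.image Prod.fst = I ∧ M.image Prod.snd = J := by
  classical
  -- Hall's condition by counting mass: the rows in `A` send at least `|A| (N - 1)` into their
  -- neighbours `B`, which absorb at most `|B| N`. If `|B| ≤ |A| - 1`, then `N ≤ |A| ≤ |I|`, a
  -- contradiction.
  obtain ⟨f, hf, hfs⟩ := (Finset.all_card_le_biUnion_card_iff_exists_injective
    (fun i : I => J.filter fun j => (i.1, j) ∈ s)).1 (by
    intro A
    set B := A.biUnion fun i : I => J.filter fun j => (i.1, j) ∈ s with hB
    have h1 : (A.card : ℝ) * (N - 1) ≤ ∑ i ∈ A, ∑ j ∈ B, w (i.1, j) := by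
      rw [← nsmul_eq_mul]
      refine Finset.card_nsmul_le_sum _ _ _ fun i hi => (hI i.1 i.2).trans (le_of_eq ?_)
      symm
      refine Finset.sum_subset (fun j hj => ?_) fun j hj hjB => hw.supp _ fun h => hjB ?_
      · obtain ⟨i', -, hj'⟩ := Finset.mem_biUnion.1 hj
        exact (Finset.mem_filter.1 hj').1
      · exact Finset.mem_biUnion.2 ⟨i, hi, Finset.mem_filter.2 ⟨hj, h⟩⟩
    have h2 : ∑ i ∈ A, ∑ j ∈ B, w (i.1, j) ≤ (B.card : ℝ) * N := by
      rw [Finset.sum_comm, ← nsmul_eq_mul]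
      refine Finset.sum_le_card_nsmul _ _ _ fun j hj => ?_
      have hjJ : j ∈ J := by
        obtain ⟨i', -, hj'⟩ := Finset.mem_biUnion.1 hj
        exact (Finset.mem_filter.1 hj').1
      refine le_trans ?_ (hJ j hjJ)
      rw [← hw.snd, ← Finset.sum_image (f := fun i => w (i, j)) (g := Subtype.val)
        Subtype.val_injective.injOn]
      exact Finset.sum_le_sum_of_subset_of_nonneg (Finset.subset_univ _) fun _ _ _ => hw.nonneg _
    have h3 : (A.card : ℝ) ≤ I.card := by
      have := Finset.card_le_univ A
      simp only [Fintype.card_coe] at this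
      exact_mod_cast this
    by_contra hlt
    have h4 : (B.card : ℝ) + 1 ≤ A.card := by
      exact_mod_cast Nat.lt_of_not_le hlt
    have hNpos : 0 < N := lt_of_le_of_lt (Nat.cast_nonneg _) hN
    nlinarith [mul_le_mul_of_nonneg_right h4 hNpos.le])
  set M : Finset (Fin m × Fin n) := Finset.univ.image fun i : I => (i.1, f i) with hM
  have hfJ : ∀ i, f i ∈ J := fun i => (Finset.mem_filter.1 (hfs i)).1
  have himg : Finset.univ.image f = J := by
    refine Finset.eq_of_subset_of_card_le (fun j hj => ?_) ?_
    · obtain ⟨i, -, rfl⟩ := Finset.mem_image.1 hj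
      exact hfJ i
    · rw [Finset.card_image_of_injective _ hf, Finset.card_univ, Fintype.card_coe, hIJ]
  refine ⟨M, fun p hp => ?_, ?_, ?_, ?_⟩
  · obtain ⟨i, -, rfl⟩ := Finset.mem_image.1 hp
    exact (Finset.mem_filter.1 (hfs i)).2
  · intro p hp q hq hpq
    obtain ⟨i, -, rfl⟩ := Finset.mem_image.1 hp
    obtain ⟨i', -, rfl⟩ := Finset.mem_image.1 hq
    have : i = i' := by
      rcases hpq with h | h
      · exact Subtype.ext h
      · exact hf h
    rw [this]
  · ext i
    simp [hM]
  · rw [← himg, hM, Finset.image_image]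
    rfl

end Matchings

namespace IsTightFamily

variable {m n : ℕ} {T : Set (Finset (Fin m × Fin n))} {h : Fin m → Fin n → ℝ}

/-- The indicators of the two matchings are plans with equal marginals. -/
lemma matching_unique (hT : IsTightFamily T h) {M M' : Finset (Fin m × Fin n)}
    (hM : M ∈ matchingsOf T) (hM' : M' ∈ matchingsOf T)
    (h1 : M.image Prod.fst = M'.image Prod.fst) (h2 : M.image Prod.snd = M'.image Prod.snd) :
    M = M' := by
  obtain ⟨-, hm, s, hs, hMs⟩ := hM
  obtain ⟨-, hm', s', hs', hMs'⟩ := hM'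
  have p1 := hm.isPlanOn.mono hMs
  have p2 := hm'.isPlanOn.mono hMs'
  rw [h1, h2] at p1
  have e := hT.plan_unique hs hs' p1 p2
  ext p
  have := congrFun e p
  by_cases a : p ∈ M <;> by_cases b : p ∈ M' <;> simp_all

/-- Solve a transport problem that is concentrated near `I × J`, and find the perfect matching
between `I` and `J` in the support. -/
lemma exists_plan_matching (hT : IsTightFamily T h) {I : Finset (Fin m)} {J : Finset (Fin n)}
    (hI : I.Nonempty) (hIJ : I.card = J.card) {N : ℝ} (hN : (I.card : ℝ) < N) {y : Fin m → ℝ}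
    {z : Fin n → ℝ} (hy : ∀ i, 0 ≤ y i) (hz : ∀ j, 0 ≤ z j) (hyz : ∑ i, y i = ∑ j, z j)
    (hyI : ∀ i ∈ I, N - 1 + ∑ j ∈ Jᶜ, z j ≤ y i) (hzJ : ∀ j ∈ J, z j ≤ N) :
    ∃ s ∈ T, ∃ w, IsPlanOn s y z w ∧ ∃ M ∈ matchingsOf T, M ⊆ s ∧
      M.image Prod.fst = I ∧ M.image Prod.snd = J := by
  obtain ⟨s, hs, w, hw⟩ := hT.cover y z hy hz hyz
  refine ⟨s, hs, w, hw, ?_⟩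
  obtain ⟨M, hMs, hM, h1, h2⟩ := hw.exists_matching hIJ hN (fun i hi => by
    have e1 := hw.fst i
    rw [← Finset.sum_add_sum_compl J] at e1
    have e2 : ∑ j ∈ Jᶜ, w (i, j) ≤ ∑ j ∈ Jᶜ, z j :=
      Finset.sum_le_sum fun j _ => hw.le_snd (i, j)
    have := hyI i hi
    linarith) hzJ
  refine ⟨M, ⟨?_, hM, s, hs, hMs⟩, hMs, h1, h2⟩
  rw [← h1] at hI
  exact Finset.image_nonempty.1 hI

theorem isMatchingEnsemble (hT : IsTightFamily T h) : IsMatchingEnsemble (matchingsOf T) where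
  matching M hM := ⟨hM.1, hM.2.1⟩
  supports I J hI hIJ := by
    have hc : (0 : ℝ) ≤ I.card := Nat.cast_nonneg _
    obtain ⟨s, hs, w, -, M, hM, -, h1, h2⟩ := hT.exists_plan_matching hI hIJ
      (N := I.card + 1) (by linarith)
      (y := fun i => if i ∈ I then (I.card : ℝ) + 1 else 0)
      (z := fun j => if j ∈ J then (I.card : ℝ) + 1 else 0)
      (fun i => by split_ifs <;> linarith) (fun j => by split_ifs <;> linarith)
      (by simp [hIJ])
      (fun i hi => by
        rw [Finset.sum_eq_zero fun j hj => if_neg (Finset.mem_compl.1 hj), if_pos hi]; linarith)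
      (fun j hj => by simp [hj])
    exact ⟨M, ⟨hM, h1, h2⟩, fun M' hM' =>
      hT.matching_unique hM'.1 hM (hM'.2.1.trans h1.symm) (hM'.2.2.trans h2.symm)⟩
  closure M hM M' hM' h0 := by
    obtain ⟨-, hm, s, hs, hMs⟩ := hM
    exact ⟨h0, hm.mono hM', s, hs, hM'.trans hMs⟩
  linkage_left M hM i hi := by
    obtain ⟨p₀, hp₀⟩ := hM.1
    set I := M.image Prod.fst with hI
    set J := M.image Prod.snd with hJ
    have hi₀ : p₀.1 ∈ I := Finset.mem_image_of_mem _ hp₀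
    have hIc : I.card = M.card := Finset.card_image_of_injOn fun p hp q hq hpq =>
      hM.2.1 p hp q hq (Or.inl hpq)
    have hJc : J.card = M.card := Finset.card_image_of_injOn fun p hp q hq hpq =>
      hM.2.1 p hp q hq (Or.inr hpq)
    have hIJ : I.card = J.card := hIc.trans hJc.symm
    have hc : (0 : ℝ) ≤ I.card := Nat.cast_nonneg _
    -- One unit of supply moves from a covered vertex to `i`. The problem stays close enough to
    -- doubly stochastic to contain a perfect matching between `I` and `J`, which by uniqueness is
    -- `M`. The unit at `i` must travel along some edge of the same simplex, and that edge ends in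
    -- `J`.
    obtain ⟨s, hs, w, hw, M', hM', hMs', h1, h2⟩ := hT.exists_plan_matching ⟨_, hi₀⟩ hIJ
      (N := I.card + 1) (by linarith)
      (y := (fun k => if k ∈ I then (I.card : ℝ) + 1 else 0) - Pi.single p₀.1 1 + Pi.single i 1)
      (z := fun j => if j ∈ J then (I.card : ℝ) + 1 else 0)
      (fun k => by
        simp only [Pi.add_apply, Pi.sub_apply, Pi.single_apply]
        split_ifs <;> first | linarith | (subst_vars; contradiction))
      (fun j => by split_ifs <;> linarith)
      (by simp [hIJ, Finset.sum_add_distrib, Finset.sum_sub_distrib])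
      (fun k hk => by
        rw [Finset.sum_eq_zero fun j hj => if_neg (Finset.mem_compl.1 hj)]
        simp only [Pi.add_apply, Pi.sub_apply, Pi.single_apply]
        split_ifs <;> linarith)
      (fun j hj => by simp [hj])
    obtain rfl := hT.matching_unique hM' hM h1 h2
    have hsum := hw.fst i
    simp only [Pi.add_apply, Pi.sub_apply, Pi.single_apply, if_neg hi,
      if_neg (fun h : i = p₀.1 => hi (h ▸ hi₀))] at hsum
    obtain ⟨j, -, hj⟩ := Finset.exists_ne_zero_of_sum_ne_zero (by
      rw [hsum]; norm_num : ∑ j, w (i, j) ≠ 0)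
    have hpos := lt_of_le_of_ne (hw.nonneg (i, j)) hj.symm
    have hjJ : j ∈ J := by
      by_contra hjJ
      have := hw.le_snd (i, j)
      simp only [if_neg hjJ] at this
      linarith
    obtain ⟨e, he, rfl⟩ := Finset.mem_image.1 hjJ
    refine ⟨e, he, (i, e.2), rfl, Or.inr rfl, Finset.insert_nonempty _ _, ?_, s, hs, ?_⟩
    · have hne : ∀ q ∈ M'.erase e, ¬ (i = q.1 ∨ e.2 = q.2) := by
        rintro q hq (h | h)
        · exact hi (h ▸ Finset.mem_image_of_mem _ (Finset.mem_of_mem_erase hq))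
        · exact Finset.ne_of_mem_erase hq
            (hM.2.1 e he q (Finset.mem_of_mem_erase hq) (Or.inr h)).symm
      intro p hp q hq hpq
      rw [Finset.mem_insert] at hp hq
      rcases hp with rfl | hp <;> rcases hq with rfl | hq
      · rfl
      · exact absurd hpq (hne q hq)
      · exact absurd (hpq.imp Eq.symm Eq.symm) (hne p hp)
      · exact hM.2.1 p (Finset.mem_of_mem_erase hp) q (Finset.mem_of_mem_erase hq) hpq
    · exact Finset.insert_subset (hw.mem_of_pos hpos) ((Finset.erase_subset _ _).trans hMs')
  linkage_right M hM j hj := by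
    obtain ⟨p₀, hp₀⟩ := hM.1
    set I := M.image Prod.fst with hI
    set J := M.image Prod.snd with hJ
    have hj₀ : p₀.2 ∈ J := Finset.mem_image_of_mem _ hp₀
    have hi₀ : p₀.1 ∈ I := Finset.mem_image_of_mem _ hp₀
    have hIc : I.card = M.card := Finset.card_image_of_injOn fun p hp q hq hpq =>
      hM.2.1 p hp q hq (Or.inl hpq)
    have hJc : J.card = M.card := Finset.card_image_of_injOn fun p hp q hq hpq =>
      hM.2.1 p hp q hq (Or.inr hpq)
    have hIJ : I.card = J.card := hIc.trans hJc.symm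
    have hc : (0 : ℝ) ≤ I.card := Nat.cast_nonneg _
    -- Dually, one unit of demand moves to `j`. The rows in `I` may lose up to this unit to columns
    -- outside `J`, exactly the slack between `N` and `N - 1`.
    obtain ⟨s, hs, w, hw, M', hM', hMs', h1, h2⟩ := hT.exists_plan_matching ⟨_, hi₀⟩ hIJ
      (N := I.card + 1) (by linarith)
      (y := fun i => if i ∈ I then (I.card : ℝ) + 1 else 0)
      (z := (fun k => if k ∈ J then (I.card : ℝ) + 1 else 0) - Pi.single p₀.2 1 + Pi.single j 1)
      (fun j => by split_ifs <;> linarith)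
      (fun k => by
        simp only [Pi.add_apply, Pi.sub_apply, Pi.single_apply]
        split_ifs <;> first | linarith | (subst_vars; contradiction))
      (by simp [hIJ, Finset.sum_add_distrib, Finset.sum_sub_distrib])
      (fun i hi => by
        rw [Finset.sum_eq_single j]
        · simp only [Pi.add_apply, Pi.sub_apply, Pi.single_apply, if_pos hi, if_neg hj,
            if_neg (fun h : j = p₀.2 => hj (h ▸ hj₀))]
          simp
        · intro k hk hkj
          have hkJ := Finset.mem_compl.1 hk
          have hkp : k ≠ p₀.2 := fun h => hkJ (h ▸ hj₀)
          simp [hkJ, hkj, hkp]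
        · intro h
          exact absurd (Finset.mem_compl.2 hj) h)
      (fun k hk => by
        have : k ≠ j := fun h => hj (h ▸ hk)
        simp only [Pi.add_apply, Pi.sub_apply, Pi.single_apply, if_pos hk, if_neg this]
        split_ifs <;> linarith)
    obtain rfl := hT.matching_unique hM' hM h1 h2
    have hsum := hw.snd j
    simp only [Pi.add_apply, Pi.sub_apply, Pi.single_apply, if_neg hj,
      if_neg (fun h : j = p₀.2 => hj (h ▸ hj₀))] at hsum
    obtain ⟨i, -, hi⟩ := Finset.exists_ne_zero_of_sum_ne_zero (by
      rw [hsum]; norm_num : ∑ i, w (i, j) ≠ 0)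
    have hpos := lt_of_le_of_ne (hw.nonneg (i, j)) hi.symm
    have hiI : i ∈ I := by
      by_contra hiI
      have := hw.le_fst (i, j)
      simp only [if_neg hiI] at this
      linarith
    obtain ⟨e, he, rfl⟩ := Finset.mem_image.1 hiI
    refine ⟨e, he, (e.1, j), rfl, Or.inl rfl, Finset.insert_nonempty _ _, ?_, s, hs, ?_⟩
    · have hne : ∀ q ∈ M'.erase e, ¬ (e.1 = q.1 ∨ j = q.2) := by
        rintro q hq (h | h)
        · exact Finset.ne_of_mem_erase hq
            (hM.2.1 e he q (Finset.mem_of_mem_erase hq) (Or.inl h)).symm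
        · exact hj (h ▸ Finset.mem_image_of_mem _ (Finset.mem_of_mem_erase hq))
      intro p hp q hq hpq
      rw [Finset.mem_insert] at hp hq
      rcases hp with rfl | hp <;> rcases hq with rfl | hq
      · rfl
      · exact absurd hpq (hne q hq)
      · exact absurd (hpq.imp Eq.symm Eq.symm) (hne p hp)
      · exact hM.2.1 p (Finset.mem_of_mem_erase hp) q (Finset.mem_of_mem_erase hq) hpq
    · exact Finset.insert_subset (hw.mem_of_pos hpos) ((Finset.erase_subset _ _).trans hMs')

end IsTightFamily

/-! ### Tails of extended Dyck paths -/

section PathTail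

variable {n : ℕ}

/-- `PathTail p q s`: the set `s` is the part of an extended Dyck path that starts at the square
`(p, q)`. -/
inductive PathTail {n : ℕ} : ℕ → ℕ → Finset (Fin (n + 1) × Fin n) → Prop
  | nil : PathTail n n ∅
  | right (i j : Fin n) (s : Finset (Fin (n + 1) × Fin n)) : i < j →
      PathTail (i.val + 1) j.val s → PathTail i.val j.val (insert (i.castSucc, j) s)
  | up (i j : Fin n) (s : Finset (Fin (n + 1) × Fin n)) : i ≤ j → j.val + 1 < n →
      PathTail i.val (j.val + 1) s → PathTail i.val j.val (insert (i.castSucc, j) s)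
  -- A block ends at its diagonal square, and the next one starts at the following diagonal square.
  -- For `j + 1 = n` only the empty tail remains.
  | close (j : Fin n) (s : Finset (Fin (n + 1) × Fin n)) : PathTail (j.val + 1) (j.val + 1) s →
      PathTail j.val j.val (insert (j.castSucc, j) (insert (Fin.last n, j) s))

variable {p q : ℕ} {s : Finset (Fin (n + 1) × Fin n)}

/-! ### Shape of a path tail: position, monotonicity and blocks -/

lemma PathTail.le_of_mem (h : PathTail p q s) {x : Fin (n + 1) × Fin n} (hx : x ∈ s) :
    p ≤ x.1.val ∧ q ≤ x.2.val := by
  induction h with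
  | nil => simp at hx
  | right i j s hij hs ih =>
    rcases Finset.mem_insert.1 hx with rfl | hx
    · simp
    · have := ih hx; omega
  | up i j s hij hj hs ih =>
    rcases Finset.mem_insert.1 hx with rfl | hx
    · simp
    · have := ih hx; omega
  | close j s hs ih =>
    rcases Finset.mem_insert.1 hx with rfl | hx
    · simp
    · rcases Finset.mem_insert.1 hx with rfl | hx
      · simp [j.isLt.le]
      · have := ih hx; omega

lemma PathTail.mem_start (h : PathTail p q s) (i j : Fin n) (hi : i.val = p) (hj : j.val = q) :
    (i.castSucc, j) ∈ s := by
  cases h with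
  | nil => omega
  | right i' j' s hij hs =>
    rw [Fin.ext hi, Fin.ext hj]; exact Finset.mem_insert_self _ _
  | up i' j' s hij hj' hs =>
    rw [Fin.ext hi, Fin.ext hj]; exact Finset.mem_insert_self _ _
  | close j' s hs =>
    rw [Fin.ext hi, Fin.ext hj]; exact Finset.mem_insert_self _ _

lemma PathTail.fst_le_snd (h : PathTail p q s) {x : Fin (n + 1) × Fin n} (hx : x ∈ s)
    (hl : x.1 ≠ Fin.last n) : x.1.val ≤ x.2.val := by
  induction h with
  | nil => simp at hx
  | right i j s hij hs ih =>
    rcases Finset.mem_insert.1 hx with rfl | hx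
    · simpa using hij.le
    · exact ih hx
  | up i j s hij hj hs ih =>
    rcases Finset.mem_insert.1 hx with rfl | hx
    · simpa using hij
    · exact ih hx
  | close j s hs ih =>
    rcases Finset.mem_insert.1 hx with rfl | hx
    · simp
    · rcases Finset.mem_insert.1 hx with rfl | hx
      · simp at hl
      · exact ih hx

lemma PathTail.snd_le_snd (h : PathTail p q s) {x y : Fin (n + 1) × Fin n} (hx : x ∈ s)
    (hy : y ∈ s) (hl : y.1 ≠ Fin.last n) (hxy : x.1 < y.1) : x.2 ≤ y.2 := by
  induction h with
  | nil => simp at hx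
  | right i j s hij hs ih =>
    rcases Finset.mem_insert.1 hx with rfl | hx <;> rcases Finset.mem_insert.1 hy with rfl | hy
    · exact le_rfl
    · exact (hs.le_of_mem hy).2
    · have := (hs.le_of_mem hx).1
      rw [Fin.lt_def] at hxy
      simp only [Fin.val_castSucc] at hxy
      omega
    · exact ih hx hy
  | up i j s hij hj hs ih =>
    rcases Finset.mem_insert.1 hx with rfl | hx <;> rcases Finset.mem_insert.1 hy with rfl | hy
    · exact le_rfl
    · have := (hs.le_of_mem hy).2
      rw [Fin.le_def]
      dsimp only at *
      omega
    · have := (hs.le_of_mem hx).1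
      rw [Fin.lt_def] at hxy
      simp only [Fin.val_castSucc] at hxy
      omega
    · exact ih hx hy
  | close j s hs ih =>
    have key : ∀ z ∈ insert (j.castSucc, j) (insert (Fin.last n, j) s), z.2 = j ∧
        j.val ≤ z.1.val ∨ z ∈ s := by
      intro z hz
      rcases Finset.mem_insert.1 hz with rfl | hz
      · exact Or.inl ⟨rfl, by simp⟩
      rcases Finset.mem_insert.1 hz with rfl | hz
      · exact Or.inl ⟨rfl, by simp [j.isLt.le]⟩
      · exact Or.inr hz
    rw [Fin.le_def]
    rw [Fin.lt_def] at hxy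
    rcases key x hx with ⟨hx2, hx1⟩ | hx' <;> rcases key y hy with ⟨hy2, -⟩ | hy'
    · rw [hx2, hy2]
    · have := hs.le_of_mem hy'
      omega
    · have h1 := hs.le_of_mem hx'
      rcases Finset.mem_insert.1 hy with rfl | hy
      · simp only [Fin.val_castSucc] at hxy
        omega
      rcases Finset.mem_insert.1 hy with rfl | hy
      · exact absurd rfl hl
      · have := hs.le_of_mem hy
        omega
    · exact ih hx' hy'

/-- A square `(n, b)` in the last column records that a Dyck path ends at `(b, b)`, so the path
leaves column `b` no higher than row `b`. This is what later allows cutting the cycle after `b`. -/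
lemma PathTail.block (h : PathTail p q s) {b : Fin n} (hb : (Fin.last n, b) ∈ s)
    {x : Fin (n + 1) × Fin n} (hx : x ∈ s) (hxb : x.1.val ≤ b.val) : x.2 ≤ b := by
  induction h with
  | nil => simp at hx
  | right i j s hij hs ih =>
    rcases Finset.mem_insert.1 hb with hb | hb
    · exact absurd (congrArg Prod.fst hb).symm (Fin.castSucc_ne_last i)
    rcases Finset.mem_insert.1 hx with rfl | hx
    · exact (hs.le_of_mem hb).2
    · exact ih hb hx
  | up i j s hij hj hs ih =>
    rcases Finset.mem_insert.1 hb with hb | hb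
    · exact absurd (congrArg Prod.fst hb).symm (Fin.castSucc_ne_last i)
    rcases Finset.mem_insert.1 hx with rfl | hx
    · have := (hs.le_of_mem hb).2
      rw [Fin.le_def]
      dsimp only at *
      omega
    · exact ih hb hx
  | close j s hs ih =>
    have hjb : j ≤ b := by
      rcases Finset.mem_insert.1 hb with hb | hb
      · exact absurd (congrArg Prod.fst hb).symm (Fin.castSucc_ne_last j)
      rcases Finset.mem_insert.1 hb with hb | hb
      · exact (congrArg Prod.snd hb).ge
      · have := (hs.le_of_mem hb).2
        rw [Fin.le_def]
        dsimp only at *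
        omega
    rcases Finset.mem_insert.1 hx with rfl | hx
    · exact hjb
    rcases Finset.mem_insert.1 hx with rfl | hx
    · exact hjb
    have h1 := hs.le_of_mem hx
    rcases Finset.mem_insert.1 hb with hb | hb
    · exact absurd (congrArg Prod.fst hb).symm (Fin.castSucc_ne_last j)
    rcases Finset.mem_insert.1 hb with hb | hb
    · have : b = j := congrArg Prod.snd hb
      subst this
      omega
    · exact ih hb hx

/-! ### Path tails as trees, and their potentials -/

/-- Solved from the end of the path: a right or up step adds one equation and one fresh unknown, and
a closing step adds two of each. Fixing `u n = 0` makes the last-column equation determine the new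
`v j`. -/
lemma PathTail.solvable (h : PathTail p q s) (g : Fin (n + 1) × Fin n → ℝ) :
    ∃ u v : ℕ → ℝ, u n = 0 ∧ ∀ x ∈ s, u x.1 + v x.2 = g x := by
  induction h with
  | nil => exact ⟨0, 0, rfl, by simp⟩
  | right i j s hij hs ih =>
    obtain ⟨u, v, hu, huv⟩ := ih
    refine ⟨Function.update u i (g (i.castSucc, j) - v j), v, ?_, ?_⟩
    · rw [Function.update_of_ne i.isLt.ne', hu]
    · intro x hx
      rcases Finset.mem_insert.1 hx with rfl | hx
      · simp
      · have := (hs.le_of_mem hx).1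
        rw [Function.update_of_ne (by omega), huv x hx]
  | up i j s hij hj hs ih =>
    obtain ⟨u, v, hu, huv⟩ := ih
    refine ⟨u, Function.update v j (g (i.castSucc, j) - u i), hu, ?_⟩
    intro x hx
    rcases Finset.mem_insert.1 hx with rfl | hx
    · simp
    · have := (hs.le_of_mem hx).2
      rw [Function.update_of_ne (by omega), huv x hx]
  | close j s hs ih =>
    obtain ⟨u, v, hu, huv⟩ := ih
    refine ⟨Function.update u j (g (j.castSucc, j) - g (Fin.last n, j)),
      Function.update v j (g (Fin.last n, j)), ?_, ?_⟩
    · rw [Function.update_of_ne j.isLt.ne', hu]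
    · intro x hx
      rcases Finset.mem_insert.1 hx with rfl | hx
      · simp
      rcases Finset.mem_insert.1 hx with rfl | hx
      · simp [Function.update_of_ne j.isLt.ne', hu]
      · have := hs.le_of_mem hx
        rw [Function.update_of_ne (by omega), Function.update_of_ne (by omega), huv x hx]

lemma PathTail.spanning (h : PathTail p q s) {u : Fin (n + 1) → ℝ} {v : Fin n → ℝ}
    (huv : ∀ x ∈ s, u x.1 + v x.2 = 0) :
    (∀ i, p ≤ i.val → u i = u (Fin.last n)) ∧ ∀ j, q ≤ j.val → v j = - u (Fin.last n) := by
  induction h with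
  | nil =>
    refine ⟨fun i hi => congrArg u (Fin.ext ?_), fun j hj => absurd j.isLt (by omega)⟩
    have := i.isLt
    simp only [Fin.val_last]
    omega
  | right i j s hij hs ih =>
    obtain ⟨h1, h2⟩ := ih fun x hx => huv x (Finset.mem_insert_of_mem hx)
    have h0 := huv _ (Finset.mem_insert_self _ _)
    refine ⟨fun k hk => ?_, h2⟩
    rcases hk.eq_or_lt with hk | hk
    · have : k = i.castSucc := Fin.ext hk.symm
      subst this
      have := h2 j le_rfl
      dsimp only at h0
      linarith
    · exact h1 k hk
  | up i j s hij hj hs ih =>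
    obtain ⟨h1, h2⟩ := ih fun x hx => huv x (Finset.mem_insert_of_mem hx)
    have h0 := huv _ (Finset.mem_insert_self _ _)
    refine ⟨h1, fun k hk => ?_⟩
    rcases hk.eq_or_lt with hk | hk
    · have : k = j := Fin.ext hk.symm
      subst this
      have := h1 i.castSucc le_rfl
      dsimp only at h0
      linarith
    · exact h2 k hk
  | close j s hs ih =>
    obtain ⟨h1, h2⟩ := ih fun x hx =>
      huv x (Finset.mem_insert_of_mem (Finset.mem_insert_of_mem hx))
    have h0 := huv _ (Finset.mem_insert_self _ _)
    have h0' := huv _ (Finset.mem_insert_of_mem (Finset.mem_insert_self _ _))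
    dsimp only at h0 h0'
    refine ⟨fun k hk => ?_, fun k hk => ?_⟩
    · rcases hk.eq_or_lt with hk | hk
      · have : k = j.castSucc := Fin.ext hk.symm
        subst this
        linarith
      · exact h1 k hk
    · rcases hk.eq_or_lt with hk | hk
      · have : k = j := Fin.ext hk.symm
        subst this
        linarith
      · exact h2 k hk

/-- The potential of a path tail for the heights `c ^ (j - i)`, normalized to vanish on the last
column. -/
lemma PathTail.potential (h : PathTail p q s) {c : ℝ} (hc : 1 < c) :
    ∃ u v : ℕ → ℝ,
      (∀ j : Fin n, q ≤ j.val → v j ≤ 1 ∧ (v j = 1 ↔ (Fin.last n, j) ∈ s)) ∧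
      (∀ i : Fin n, p ≤ i.val → ∃ b : Fin n, i ≤ b ∧ q ≤ b.val ∧ v b = 1) ∧
      ∀ i j : Fin n, p ≤ i.val → q ≤ j.val → i ≤ j →
        u i + v j ≤ c ^ (j.val - i.val) ∧ (u i + v j = c ^ (j.val - i.val) ↔
          (i.castSucc, j) ∈ s) := by
  have hc0 : 0 < c := by linarith
  induction h with
  | nil =>
    exact ⟨0, 0, fun j hj => absurd j.isLt (by omega), fun i hi => absurd i.isLt (by omega),
      fun i j hi => absurd i.isLt (by omega)⟩
  | right i j s hij hs ih =>
    obtain ⟨u, v, h1, h2, h3⟩ := ih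
    have hij' : i.val < j.val := hij
    refine ⟨Function.update u i (c ^ (j.val - i.val) - v j), v, fun k hk => ?_, fun k hk => ?_,
      fun k l hk hl hkl => ?_⟩
    · refine ⟨(h1 k hk).1, (h1 k hk).2.trans ?_⟩
      rw [Finset.mem_insert, or_iff_right]
      exact fun h => Fin.castSucc_ne_last i (congrArg Prod.fst h).symm
    · by_cases hki : k = i
      · subst hki
        obtain ⟨b, hb1, hb2, hb3⟩ := h2 ⟨k.val + 1, by omega⟩ le_rfl
        rw [Fin.le_def] at hb1
        dsimp only at hb1
        exact ⟨b, by rw [Fin.le_def]; omega, hb2, hb3⟩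
      · have : k.val ≠ i.val := fun h => hki (Fin.ext h)
        exact h2 k (by omega)
    · by_cases hki : k = i
      · subst hki
        rw [Function.update_self]
        by_cases hlj : l = j
        · subst hlj
          simp
        · have hlj' : j.val < l.val := lt_of_le_of_ne hl fun h => hlj (Fin.ext h.symm)
          have hne : (k.castSucc, l) ∉ insert (k.castSucc, j) s := by
            rw [Finset.mem_insert, not_or]
            refine ⟨fun h => hlj (congrArg Prod.snd h), fun h => ?_⟩
            have := (hs.le_of_mem h).1
            simp at this
          set k' : Fin n := ⟨k.val + 1, by omega⟩ with hk'
          have e1 := (h3 k' j le_rfl le_rfl (by rw [Fin.le_def]; dsimp only [k']; omega)).2.2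
            (hs.mem_start k' j rfl rfl)
          have e2 := (h3 k' l le_rfl hl (by rw [Fin.le_def]; dsimp only [k']; omega)).1
          obtain ⟨a, ha⟩ : ∃ a, j.val = k.val + 1 + a := ⟨_, (Nat.add_sub_of_le hij').symm⟩
          obtain ⟨d, hd⟩ : ∃ d, l.val = k.val + 1 + a + d :=
            ⟨_, by rw [← ha]; exact (Nat.add_sub_of_le hl).symm⟩
          have hlt : c ^ a < c ^ (a + d) := pow_lt_pow_right₀ hc (by omega)
          have f1 : j.val - k'.val = a := by dsimp only [k']; omega
          have f2 : l.val - k'.val = a + d := by dsimp only [k']; omega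
          have f3 : j.val - k.val = a + 1 := by omega
          have f4 : l.val - k.val = a + d + 1 := by omega
          rw [f1] at e1
          rw [f2] at e2
          rw [f3, f4]
          -- Column `k + 1` gives `v l - v j ≤ c ^ (a + d) - c ^ a`. The claim reduces to `(c - 1) *
          -- c ^ a < (c - 1) * c ^ (a + d)`, the strict convexity of the heights.
          have hl' : c ^ (a + 1) - v j + v l < c ^ (a + d + 1) := by
            rw [pow_succ, pow_succ]
            nlinarith
          exact ⟨hl'.le, fun h => absurd h hl'.ne, fun h => absurd h hne⟩
      · have hki' : k.val ≠ i.val := fun h => hki (Fin.ext h)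
        rw [Function.update_of_ne hki', Finset.mem_insert, or_iff_right]
        · exact h3 k l (by omega) hl hkl
        · exact fun h => hki (Fin.castSucc_injective n (congrArg Prod.fst h))
  | up i j s hij hj hs ih =>
    obtain ⟨u, v, h1, h2, h3⟩ := ih
    have hij' : i.val ≤ j.val := hij
    set j' : Fin n := ⟨j.val + 1, hj⟩ with hj'
    have e1 := (h3 i j' le_rfl le_rfl (by rw [Fin.le_def]; dsimp only [j']; omega)).2.2
      (hs.mem_start i j' rfl rfl)
    have f1 : j'.val - i.val = j.val - i.val + 1 := by dsimp only [j']; omega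
    rw [f1] at e1
    -- Row `j` has no last-column square here, so strictness is required. It follows from `u i ≥ c ^
    -- (j - i + 1) - 1`, by tightness at `(i, j + 1)`.
    have hvj : c ^ (j.val - i.val) - u i < 1 := by
      have : c ^ (j.val - i.val) < c ^ (j.val - i.val + 1) := pow_lt_pow_right₀ hc (by omega)
      have := (h1 j' le_rfl).1
      linarith
    refine ⟨u, Function.update v j (c ^ (j.val - i.val) - u i), fun k hk => ?_, fun k hk => ?_,
      fun k l hk hl hkl => ?_⟩
    · rw [Finset.mem_insert, or_iff_right fun h => Fin.castSucc_ne_last i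
        (congrArg Prod.fst h).symm]
      by_cases hkj : k = j
      · subst hkj
        rw [Function.update_self]
        refine ⟨hvj.le, fun h => absurd h hvj.ne, fun h => ?_⟩
        have := (hs.le_of_mem h).2
        simp at this
      · have hkj' : k.val ≠ j.val := fun h => hkj (Fin.ext h)
        rw [Function.update_of_ne hkj']
        exact h1 k (by omega)
    · obtain ⟨b, hb1, hb2, hb3⟩ := h2 k hk
      refine ⟨b, hb1, by omega, ?_⟩
      rw [Function.update_of_ne (by omega), hb3]
    · by_cases hlj : l = j
      · subst hlj
        rw [Function.update_self]
        by_cases hki : k = i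
        · subst hki
          simp
        · have hki' : i.val < k.val := lt_of_le_of_ne hk fun h => hki (Fin.ext h.symm)
          have hkl' : k.val ≤ l.val := hkl
          have hne : (k.castSucc, l) ∉ insert (i.castSucc, l) s := by
            rw [Finset.mem_insert, not_or]
            refine ⟨fun h => hki (Fin.castSucc_injective n (congrArg Prod.fst h)), fun h => ?_⟩
            have := (hs.le_of_mem h).2
            simp at this
          have e2 := (h3 k j' hk le_rfl (by rw [Fin.le_def]; dsimp only [j']; omega)).1
          have f2 : j'.val - k.val = l.val - k.val + 1 := by dsimp only [j']; omega
          rw [f2] at e2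
          have hlt : c ^ (l.val - k.val) < c ^ (l.val - i.val) :=
            pow_lt_pow_right₀ hc (by omega)
          -- The same convexity argument with the roles of rows and columns exchanged, comparing
          -- with row `l + 1`.
          have hl' : u k + (c ^ (l.val - i.val) - u i) < c ^ (l.val - k.val) := by
            rw [pow_succ] at e1 e2
            nlinarith
          exact ⟨hl'.le, fun h => absurd h hl'.ne, fun h => absurd h hne⟩
      · have hlj' : l.val ≠ j.val := fun h => hlj (Fin.ext h)
        rw [Function.update_of_ne hlj', Finset.mem_insert,
          or_iff_right fun h => hlj (congrArg Prod.snd h)]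
        exact h3 k l hk (by omega) hkl
  | close j s hs ih =>
    obtain ⟨u, v, h1, h2, h3⟩ := ih
    -- Both values are forced by tightness at the height-one squares `(n, j)` and `(j, j)`.
    refine ⟨Function.update u j 0, Function.update v j 1, fun k hk => ?_, fun k hk => ?_,
      fun k l hk hl hkl => ?_⟩
    · by_cases hkj : k = j
      · subst hkj
        simp
      · have hkj' : k.val ≠ j.val := fun h => hkj (Fin.ext h)
        rw [Function.update_of_ne hkj', Finset.mem_insert, Finset.mem_insert,
          or_iff_right fun h => Fin.castSucc_ne_last j (congrArg Prod.fst h).symm,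
          or_iff_right fun h => hkj (congrArg Prod.snd h)]
        exact h1 k (by omega)
    · by_cases hkj : k = j
      · subst hkj
        exact ⟨k, le_rfl, le_rfl, by simp⟩
      · have hkj' : k.val ≠ j.val := fun h => hkj (Fin.ext h)
        obtain ⟨b, hb1, hb2, hb3⟩ := h2 k (by omega)
        exact ⟨b, hb1, by omega, by rw [Function.update_of_ne (by omega), hb3]⟩
    · have hkl' : k.val ≤ l.val := hkl
      rw [Finset.mem_insert, Finset.mem_insert, or_congr_right (or_iff_right fun h =>
        Fin.castSucc_ne_last k (congrArg Prod.fst h))]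
      by_cases hkj : k = j
      · subst hkj
        rw [Function.update_self]
        by_cases hlj : l = k
        · subst hlj
          simp
        · have hlj' : k.val < l.val := lt_of_le_of_ne hl fun h => hlj (Fin.ext h.symm)
          rw [Function.update_of_ne hlj'.ne', or_iff_right fun h => hlj (congrArg Prod.snd h)]
          have := (h1 l hlj').1
          have hlt : 1 < c ^ (l.val - k.val) := one_lt_pow₀ hc (by omega)
          have hl' : 0 + v l < c ^ (l.val - k.val) := by linarith
          refine ⟨hl'.le, fun h => absurd h hl'.ne, fun h => ?_⟩
          have := (hs.le_of_mem h).1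
          simp at this
      · have hkj' : k.val ≠ j.val := fun h => hkj (Fin.ext h)
        rw [Function.update_of_ne hkj', Function.update_of_ne (by omega),
          or_iff_right fun h => hkj (Fin.castSucc_injective n (congrArg Prod.fst h))]
        exact h3 k l (by omega) (by omega) hkl

end PathTail

section PathTail

variable {n : ℕ} {p q : ℕ} {s : Finset (Fin (n + 1) × Fin n)}

/-! ### Path tails and extended Dyck paths -/

lemma PathTail.of_isChain {b : Fin n} {s : Finset (Fin (n + 1) × Fin n)}
    (hs : PathTail (b.val + 1) (b.val + 1) s) (l : List (Fin (n + 1) × Fin n)) :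
    ∀ x, l.head? = some x → l.getLast? = some (b.castSucc, b) → l.IsChain GridStep →
      (∀ p ∈ l, p.1.val ≤ p.2.val) →
      PathTail x.1.val x.2.val (insert (Fin.last n, b) (l.toFinset ∪ s)) := by
  induction l with
  | nil => simp
  | cons a l ih =>
    intro x hx hlast hchain hle
    obtain rfl : a = x := by simpa using hx
    cases l with
    | nil =>
      obtain rfl : a = (b.castSucc, b) := by simpa using hlast
      have := PathTail.close b s hs
      rw [Finset.insert_comm] at this
      simpa using this
    | cons a' l =>
      have ih' := ih a' rfl (by simpa [List.getLast?_cons_cons] using hlast)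
        (List.isChain_cons_cons.1 hchain).2 fun p hp => hle p (List.mem_cons_of_mem _ hp)
      have hstep := (List.isChain_cons_cons.1 hchain).1
      have ha := hle a List.mem_cons_self
      have ha' := hle a' (List.mem_cons_of_mem _ List.mem_cons_self)
      obtain ⟨i, j⟩ := a
      obtain ⟨i', j'⟩ := a'
      have hin : i.val < n := lt_of_le_of_lt ha j.isLt
      obtain ⟨i, rfl⟩ : ∃ k : Fin n, i = k.castSucc := ⟨⟨i, hin⟩, rfl⟩
      have e : insert (Fin.last n, b) (((i.castSucc, j) :: (i', j') :: l).toFinset ∪ s) =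
          insert (i.castSucc, j) (insert (Fin.last n, b) (((i', j') :: l).toFinset ∪ s)) := by
        rw [List.toFinset_cons (l := (i', j') :: l), Finset.insert_union, Finset.insert_comm]
      rw [e]
      rcases hstep with ⟨h1, h2⟩ | ⟨h1, h2⟩
      · dsimp only at h1 h2 ih' ha ha'
        subst h2
        rw [h1] at ih' ha'
        exact PathTail.right i j' _ ha' ih'
      · dsimp only at h1 h2 ih' ha ha'
        subst h1
        rw [h2] at ih' ha'
        exact PathTail.up i j _ ha (h2 ▸ j'.isLt) ih'

lemma PathTail.of_isExtDyckFrom {a : ℕ} (h : IsExtDyckFrom a s) : PathTail a a s := by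
  induction h with
  | nil => exact PathTail.nil
  | cons a b D s hD hs ih =>
    obtain ⟨l, h1, h2, h3, h4, rfl⟩ := hD
    exact PathTail.of_isChain ih l _ h1 h2 h3 h4

/-- The unfinished first block is kept as an explicit list, while all later blocks are already
packed into `IsExtDyckFrom`. This makes the induction over single squares possible. -/
lemma PathTail.exists_isChain (h : PathTail p q s) :
    (p = n ∧ q = n ∧ s = ∅) ∨ ∃ (i j b : Fin n) (l : List (Fin (n + 1) × Fin n))
      (s' : Finset (Fin (n + 1) × Fin n)), i.val = p ∧ j.val = q ∧
      l.head? = some (i.castSucc, j) ∧ l.getLast? = some (b.castSucc, b) ∧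
      l.IsChain GridStep ∧ (∀ p ∈ l, p.1.val ≤ p.2.val) ∧
      IsExtDyckFrom (b.val + 1) s' ∧ s = insert (Fin.last n, b) (l.toFinset ∪ s') := by
  have step : ∀ (i j i' j' b : Fin n) (l : List (Fin (n + 1) × Fin n))
      (s' : Finset (Fin (n + 1) × Fin n)), i ≤ j → GridStep (i.castSucc, j) (i'.castSucc, j') →
      l.head? = some (i'.castSucc, j') → l.getLast? = some (b.castSucc, b) →
      l.IsChain GridStep → (∀ p ∈ l, p.1.val ≤ p.2.val) →
      ((i.castSucc, j) :: l).head? = some (i.castSucc, j) ∧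
      ((i.castSucc, j) :: l).getLast? = some (b.castSucc, b) ∧
      ((i.castSucc, j) :: l).IsChain GridStep ∧
      (∀ p ∈ (i.castSucc, j) :: l, p.1.val ≤ p.2.val) ∧
      insert (i.castSucc, j) (insert (Fin.last n, b) (l.toFinset ∪ s')) =
        insert (Fin.last n, b) (((i.castSucc, j) :: l).toFinset ∪ s') := by
    intro i j i' j' b l s' hij hstep h1 h2 h3 h4
    obtain ⟨a, l, rfl⟩ : ∃ a l', l = a :: l' := by
      cases l with
      | nil => simp at h1
      | cons a l => exact ⟨a, l, rfl⟩
    obtain rfl : a = (i'.castSucc, j') := by simpa using h1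
    refine ⟨rfl, by simpa [List.getLast?_cons_cons] using h2,
      List.isChain_cons_cons.2 ⟨hstep, h3⟩, List.forall_mem_cons.2 ⟨hij, h4⟩, ?_⟩
    rw [List.toFinset_cons (a := (i.castSucc, j)), Finset.insert_union, Finset.insert_comm]
  induction h with
  | nil => exact Or.inl ⟨rfl, rfl, rfl⟩
  | right i j s hij hs ih =>
    rcases ih with ⟨h1, h2, -⟩ | ⟨i', j', b, l, s', hi', hj', h1, h2, h3, h4, h5, rfl⟩
    · have := j.isLt
      omega
    · obtain rfl := Fin.ext hj'
      obtain ⟨g1, g2, g3, g4, g5⟩ := step i j' i' j' b l s' hij.le (Or.inl ⟨hi', rfl⟩) h1 h2 h3 h4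
      exact Or.inr ⟨i, j', b, _, s', rfl, rfl, g1, g2, g3, g4, h5, g5⟩
  | up i j s hij hj hs ih =>
    rcases ih with ⟨h1, h2, -⟩ | ⟨i', j', b, l, s', hi', hj', h1, h2, h3, h4, h5, rfl⟩
    · omega
    · obtain rfl := Fin.ext hi'
      obtain ⟨g1, g2, g3, g4, g5⟩ := step i' j i' j' b l s' hij (Or.inr ⟨rfl, hj'⟩) h1 h2 h3 h4
      exact Or.inr ⟨i', j, b, _, s', rfl, rfl, g1, g2, g3, g4, h5, g5⟩
  | close j s hs ih =>
    refine Or.inr ⟨j, j, j, [(j.castSucc, j)], s, rfl, rfl, rfl, rfl, by simp, by simp, ?_, ?_⟩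
    · rcases ih with ⟨h1, -, rfl⟩ | ⟨i', j', b, l, s', hi', hj', h1, h2, h3, h4, h5, rfl⟩
      · rw [h1]
        exact IsExtDyckFrom.nil
      · obtain rfl : i' = j' := Fin.ext (hi'.trans hj'.symm)
        rw [← hi']
        exact IsExtDyckFrom.cons i' b l.toFinset s' ⟨l, h1, h2, h3, h4, rfl⟩ h5
    · rw [Finset.insert_comm]
      simp

lemma isExtDyckPath_iff (hn : n ≠ 0) : IsExtDyckPath s ↔ PathTail 0 0 s := by
  refine ⟨PathTail.of_isExtDyckFrom, fun h => ?_⟩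
  rcases h.exists_isChain with ⟨h1, -, -⟩ | ⟨i, j, b, l, s', hi, hj, h1, h2, h3, h4, h5, rfl⟩
  · exact absurd h1.symm hn
  · obtain rfl : i = j := Fin.ext (hi.trans hj.symm)
    have := IsExtDyckFrom.cons i b l.toFinset s' ⟨l, h1, h2, h3, h4, rfl⟩ h5
    rwa [hi] at this

/-! ### Existence of path tails -/

/-- A non-crossing weakly increasing set of squares is covered by a path tail. -/
lemma PathTail.exists_of_nonCrossing {M : Finset (Fin (n + 1) × Fin n)}
    (hM : ∀ x ∈ M, ∀ y ∈ M, x.1 < y.1 → x.2 ≤ y.2)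
    (hM' : ∀ x ∈ M, x.1 ≠ Fin.last n → x.1.val ≤ x.2.val) (k : ℕ) :
    ∀ p q : ℕ, p ≤ q → (q < n ∨ p = n ∧ q = n) → (n - p) + (n - q) ≤ k →
      ∃ s, PathTail p q s ∧ ∀ x ∈ M, p ≤ x.1.val → q ≤ x.2.val → x ∈ s := by
  have base : ∃ s : Finset (Fin (n + 1) × Fin n), PathTail n n s ∧
      ∀ x ∈ M, n ≤ x.1.val → n ≤ x.2.val → x ∈ s :=
    ⟨∅, PathTail.nil, fun x _ _ hx => absurd x.2.isLt (by omega)⟩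
  induction k with
  | zero =>
    intro p q hpq hq hk
    obtain ⟨rfl, rfl⟩ : p = n ∧ q = n := by omega
    exact base
  | succ k ih =>
    intro p q hpq hq hk
    rcases hq with hq | ⟨rfl, rfl⟩
    swap
    · exact base
    set i : Fin n := ⟨p, by omega⟩ with hi
    set j : Fin n := ⟨q, hq⟩ with hj
    have hext : ∀ x : Fin (n + 1) × Fin n, x.1.val = p → x.2.val = q → x = (i.castSucc, j) :=
      fun x h1 h2 => Prod.ext (Fin.ext h1) (Fin.ext h2)
    -- The path goes up exactly when column `p` still has a square of `M` above row `q`.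
    -- Non-crossing then rules out squares of `M` further right in row `q`.
    by_cases hup : ∃ x ∈ M, x.1.val = p ∧ q < x.2.val
    · obtain ⟨x, hx, hxp, hxq⟩ := hup
      have hq1 : q + 1 < n := lt_of_le_of_lt hxq x.2.isLt
      obtain ⟨s, hs, hMs⟩ := ih p (q + 1) (by omega) (Or.inl hq1) (by omega)
      refine ⟨_, PathTail.up i j s hpq hq1 hs, fun y hy hy1 hy2 => ?_⟩
      rcases hy2.eq_or_lt with hy2 | hy2
      · rcases hy1.eq_or_lt with hy1 | hy1
        · rw [hext y hy1.symm hy2.symm]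
          exact Finset.mem_insert_self _ _
        · have := hM x hx y hy (by rw [Fin.lt_def]; omega)
          rw [Fin.le_def] at this
          omega
      · exact Finset.mem_insert_of_mem (hMs y hy hy1 hy2)
    · push Not at hup
      rcases hpq.eq_or_lt with rfl | hpq
      · obtain ⟨s, hs, hMs⟩ := ih (p + 1) (p + 1) le_rfl (by omega) (by omega)
        refine ⟨_, PathTail.close j s hs, fun y hy hy1 hy2 => ?_⟩
        rcases hy2.eq_or_lt with hy2 | hy2
        · by_cases hl : y.1 = Fin.last n
          · refine Finset.mem_insert_of_mem (Finset.mem_insert.2 (Or.inl ?_))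
            exact Prod.ext hl (Fin.ext hy2.symm)
          · have := hM' y hy hl
            rw [hext y (by omega) hy2.symm]
            exact Finset.mem_insert_self _ _
        · refine Finset.mem_insert_of_mem (Finset.mem_insert_of_mem (hMs y hy ?_ hy2))
          have := hup y hy
          omega
      · obtain ⟨s, hs, hMs⟩ := ih (p + 1) q (by omega) (Or.inl hq) (by omega)
        refine ⟨_, PathTail.right i j s hpq hs, fun y hy hy1 hy2 => ?_⟩
        rcases hy1.eq_or_lt with hy1 | hy1
        · have := hup y hy hy1.symm
          rw [hext y hy1.symm (by omega)]
          exact Finset.mem_insert_self _ _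
        · exact Finset.mem_insert_of_mem (hMs y hy hy1 hy2)

/-! ### The north-west corner rule -/

lemma IsPlanOn.add_single {y : Fin (n + 1) → ℝ} {z : Fin n → ℝ} {w : Fin (n + 1) × Fin n → ℝ}
    (hw : IsPlanOn s y z w) (x : Fin (n + 1) × Fin n) {r : ℝ} (hr : 0 ≤ r) :
    IsPlanOn (insert x s) (y + Pi.single x.1 r) (z + Pi.single x.2 r) (w + Pi.single x r) := by
  refine ⟨fun k => ?_, fun k hk => ?_, fun i => ?_, fun j => ?_⟩
  · simp only [Pi.add_apply, Pi.single_apply]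
    have := hw.nonneg k
    split_ifs <;> linarith
  · rw [Finset.mem_insert, not_or] at hk
    simp [hw.supp k hk.2, hk.1]
  · simp only [Pi.add_apply, Finset.sum_add_distrib, hw.fst, Pi.single_apply, Prod.ext_iff]
    by_cases h : i = x.1 <;> simp [h]
  · simp only [Pi.add_apply, Finset.sum_add_distrib, hw.snd, Pi.single_apply, Prod.ext_iff]
    by_cases h : j = x.2 <;> simp [h]

/-- Supplies `y` and demands `z` that remain at the square `(p, q)` of the north-west corner rule:
the supply of the labels from each `r > q` on is at most the demand of these labels. -/
structure FeasibleFrom (p q : ℕ) (y : Fin (n + 1) → ℝ) (z : Fin n → ℝ) : Prop where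
  nonneg_fst : ∀ i, 0 ≤ y i
  nonneg_snd : ∀ j, 0 ≤ z j
  sum_eq : ∑ i, y i = ∑ j, z j
  fst_zero : ∀ i : Fin n, i.val < p → y i.castSucc = 0
  snd_zero : ∀ j : Fin n, j.val < q → z j = 0
  suffix : ∀ r, q < r → ∑ i : Fin n with r ≤ i.val, (y i.castSucc - z i) ≤ 0

namespace FeasibleFrom

variable {y : Fin (n + 1) → ℝ} {z : Fin n → ℝ}

lemma sub_single (h : FeasibleFrom p q y z) {i : Fin (n + 1)} {j : Fin n} (hpi : p ≤ i.val)
    (hi : i.val ≤ q ∨ i = Fin.last n) (hj : j.val = q) {r : ℝ} (hri : r ≤ y i)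
    (hrj : r ≤ z j) : FeasibleFrom p q (y - Pi.single i r) (z - Pi.single j r) := by
  refine ⟨fun k => ?_, fun k => ?_, ?_, fun k hk => ?_, fun k hk => ?_, fun m hm => ?_⟩
  · rw [Pi.sub_apply, Pi.single_apply]
    split_ifs with hk
    · rw [hk]; linarith
    · linarith [h.nonneg_fst k]
  · rw [Pi.sub_apply, Pi.single_apply]
    split_ifs with hk
    · rw [hk]; linarith
    · linarith [h.nonneg_snd k]
  · simp [Finset.sum_sub_distrib, h.sum_eq]
  · have : k.castSucc ≠ i := by rintro rfl; simp at hpi; omega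
    simp [this, h.fst_zero k hk]
  · have : k ≠ j := by rintro rfl; omega
    simp [this, h.snd_zero k hk]
  · refine le_trans (le_of_eq (Finset.sum_congr rfl fun k hk => ?_)) (h.suffix m hm)
    have hmk := (Finset.mem_filter.1 hk).2
    have h1 : k.castSucc ≠ i := by
      rintro rfl
      rcases hi with hi | hi
      · simp at hi; omega
      · exact Fin.castSucc_ne_last k hi
    have h2 : k ≠ j := by rintro rfl; omega
    simp [h1, h2]

lemma succ_fst (h : FeasibleFrom p q y z) (i : Fin n) (hi : i.val = p) (hy : y i.castSucc = 0) :
    FeasibleFrom (p + 1) q y z :=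
  { h with
    fst_zero := fun k hk => by
      rcases (Nat.le_of_lt_succ hk).eq_or_lt with hk | hk
      · rw [Fin.ext (hk.trans hi.symm), hy]
      · exact h.fst_zero k hk }

lemma succ_snd (h : FeasibleFrom p q y z) (j : Fin n) (hj : j.val = q) (hz : z j = 0) :
    FeasibleFrom p (q + 1) y z :=
  { h with
    snd_zero := fun k hk => by
      rcases (Nat.le_of_lt_succ hk).eq_or_lt with hk | hk
      · rw [Fin.ext (hk.trans hj.symm), hz]
      · exact h.snd_zero k hk
    suffix := fun r hr => h.suffix r (by omega) }

/-- By total balance the supply of the last column equals `z j` minus the surplus of the labels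
beyond `q`, and that surplus is nonpositive. So the last column can finish row `q` when a block
closes. -/
lemma le_last (h : FeasibleFrom (q + 1) q y z) (j : Fin n) (hj : j.val = q) :
    z j ≤ y (Fin.last n) := by
  have e := h.sum_eq
  rw [Fin.sum_univ_castSucc] at e
  have e1 : ∑ i : Fin n, (y i.castSucc - z i) =
      ∑ i : Fin n with q + 1 ≤ i.val, (y i.castSucc - z i) - z j := by
    rw [← Finset.sum_filter_add_sum_filter_not Finset.univ (fun i : Fin n => q + 1 ≤ i.val),
      sub_eq_add_neg]
    congr 1
    rw [Finset.sum_eq_single j]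
    · rw [h.fst_zero j (by omega), zero_sub]
    · intro k hk hkj
      have hk' := (Finset.mem_filter.1 hk).2
      have : k.val ≠ j.val := fun h => hkj (Fin.ext h)
      rw [h.fst_zero k (by omega), h.snd_zero k (by omega), sub_zero]
    · intro hk
      exact absurd (Finset.mem_filter.2 ⟨Finset.mem_univ _, by omega⟩) hk
  rw [Finset.sum_sub_distrib] at e1
  linarith [h.suffix (q + 1) (by omega)]

lemma snd_lt_of_lt (h : FeasibleFrom p q y z) (i : Fin (n + 1)) (j : Fin n) (hj : j.val = q)
    (hlt : z j < y i) : q + 1 < n := by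
  by_contra hq
  have e1 : ∑ k, z k = z j := by
    refine Finset.sum_eq_single j (fun k _ hkj => h.snd_zero k ?_) (by simp)
    have : k.val ≠ j.val := fun h => hkj (Fin.ext h)
    omega
  have e2 := Finset.single_le_sum (fun k _ => h.nonneg_fst k) (Finset.mem_univ i)
  linarith [h.sum_eq]

/-- The north-west corner rule: a feasible transport problem has a solution supported on a path
tail. -/
lemma exists_plan (k : ℕ) : ∀ (p q : ℕ) (y : Fin (n + 1) → ℝ) (z : Fin n → ℝ), p ≤ q →
    (q < n ∨ p = n ∧ q = n) → (n - p) + (n - q) ≤ k → FeasibleFrom p q y z →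
      ∃ s, PathTail p q s ∧ ∃ w, IsPlanOn s y z w := by
  have base : ∀ (y : Fin (n + 1) → ℝ) (z : Fin n → ℝ), FeasibleFrom n n y z →
      ∃ s, PathTail n n s ∧ ∃ w, IsPlanOn s y z w := by
    intro y z h
    have hz : ∀ j, z j = 0 := fun j => h.snd_zero j j.isLt
    have hy : ∀ i, y i = 0 := by
      have := h.sum_eq
      rw [Finset.sum_eq_zero fun j _ => hz j,
        Finset.sum_eq_zero_iff_of_nonneg fun i _ => h.nonneg_fst i] at this
      exact fun i => this i (Finset.mem_univ i)
    exact ⟨∅, PathTail.nil, 0, fun _ => le_rfl, fun _ _ => rfl, fun i => by simp [hy],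
      fun j => by simp [hz]⟩
  induction k with
  | zero =>
    intro p q y z hpq hq hk h
    obtain ⟨rfl, rfl⟩ : p = n ∧ q = n := by omega
    exact base y z h
  | succ k ih =>
    intro p q y z hpq hq hk h
    rcases hq with hq | ⟨rfl, rfl⟩
    swap
    · exact base y z h
    set i : Fin n := ⟨p, by omega⟩ with hi
    set j : Fin n := ⟨q, hq⟩ with hj
    -- As much as possible is shipped on the current square. Excess supply forces an up step;
    -- otherwise column `p` is exhausted. The path then moves right or, on the diagonal, the last
    -- column meets the remaining demand.
    rcases lt_or_ge (z j) (y i.castSucc) with hlt | hle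
    · have hq1 := h.snd_lt_of_lt i.castSucc j rfl hlt
      have h' := (h.sub_single (i := i.castSucc) (j := j) le_rfl (Or.inl hpq) rfl
        hlt.le le_rfl).succ_snd j rfl (by simp)
      obtain ⟨s, hs, w, hw⟩ := ih p (q + 1) _ _ (by omega) (Or.inl hq1) (by omega) h'
      have hw' := hw.add_single (i.castSucc, j) (h.nonneg_snd j)
      simp only [sub_add_cancel] at hw'
      exact ⟨_, PathTail.up i j s hpq hq1 hs, _, hw'⟩
    · have h' := (h.sub_single (i := i.castSucc) (j := j) le_rfl (Or.inl hpq) rfl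
        le_rfl hle).succ_fst i rfl (by simp)
      rcases hpq.eq_or_lt with rfl | hpq
      · have hlast := h'.le_last j rfl
        have h2 := (h'.sub_single (i := Fin.last n) (j := j) (by simp; omega) (Or.inr rfl) rfl
          hlast le_rfl).succ_snd j rfl (by simp)
        obtain ⟨s, hs, w, hw⟩ := ih (p + 1) (p + 1) _ _ le_rfl (by omega) (by omega) h2
        have hw' := (hw.add_single (Fin.last n, j) (h'.nonneg_snd j)).add_single (i.castSucc, j)
          (h.nonneg_fst i.castSucc)
        simp only [sub_add_cancel] at hw'
        exact ⟨_, PathTail.close j s hs, _, hw'⟩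
      · obtain ⟨s, hs, w, hw⟩ := ih (p + 1) q _ _ (by omega) (Or.inl hq) (by omega) h'
        have hw' := hw.add_single (i.castSucc, j) (h.nonneg_fst i.castSucc)
        simp only [sub_add_cancel] at hw'
        exact ⟨_, PathTail.right i j s hpq hs, _, hw'⟩

end FeasibleFrom

end PathTail

variable {n : ℕ}

/-! ### Heights of extended Dyck paths -/

/-- Both branches of the height are the power of the cyclic difference in `Fin n`, whence the
invariance under shifts. -/
lemma dyckHeight_castSucc (c : ℝ) (i j : Fin n) :
    dyckHeight n c i.castSucc j = c ^ (j - i).val := by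
  rw [dyckHeight, if_neg (Fin.castSucc_ne_last i), Fin.val_castSucc]
  split_ifs with h
  · rw [Fin.sub_val_of_le h]
  · rw [Fin.coe_sub_iff_lt.2 (Fin.lt_def.2 (not_le.1 h))]

lemma dyckHeight_last (c : ℝ) (j : Fin n) : dyckHeight n c (Fin.last n) j = 1 :=
  if_pos rfl

lemma PathTail.isTightOn {s : Finset (Fin (n + 1) × Fin n)} (hs : PathTail 0 0 s) {c : ℝ}
    (hc : 1 < c) : ∃ u v, IsTightOn (dyckHeight n c) s u v := by
  obtain ⟨U, V, h1, h2, h3⟩ := hs.potential hc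
  refine ⟨Fin.lastCases 0 fun i => U i, fun j => V j, fun i j => ?_⟩
  induction i using Fin.lastCases with
  | last => simpa [dyckHeight_last] using h1 j (Nat.zero_le _)
  | cast i =>
    simp only [Fin.lastCases_castSucc, dyckHeight_castSucc]
    rcases le_or_gt i j with hij | hij
    · rw [Fin.sub_val_of_le hij]
      exact h3 i j (Nat.zero_le _) (Nat.zero_le _) hij
    · obtain ⟨b, hb, -, hVb⟩ := h2 i (Nat.zero_le _)
      have e1 := (h3 i b (Nat.zero_le _) (Nat.zero_le _) hb).1
      have e2 := (h1 j (Nat.zero_le _)).1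
      have e3 : c ^ (b.val - i.val) < c ^ (j - i).val := by
        rw [Fin.coe_sub_iff_lt.2 hij]
        exact pow_lt_pow_right₀ hc (by omega)
      have e4 : U i + V j < c ^ (j - i).val := by linarith
      refine ⟨e4.le, fun h => absurd h e4.ne, fun h => ?_⟩
      have := hs.fst_le_snd h (Fin.castSucc_ne_last i)
      rw [Fin.lt_def] at hij
      simp only [Fin.val_castSucc] at this
      omega

/-! ### Cyclic shifts -/

variable [NeZero n]

@[simp]
lemma shiftFst_castSucc (ℓ i : Fin n) : shiftFst ℓ i.castSucc = (i + ℓ).castSucc := by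
  simp [shiftFst]

@[simp]
lemma shiftFst_last (ℓ : Fin n) : shiftFst ℓ (Fin.last n) = Fin.last n := by
  simp [shiftFst]

lemma shiftFst_shiftFst (k ℓ : Fin n) (i : Fin (n + 1)) :
    shiftFst k (shiftFst ℓ i) = shiftFst (ℓ + k) i := by
  induction i using Fin.lastCases with
  | last => simp
  | cast i => simp [add_assoc]

lemma shiftFst_zero (i : Fin (n + 1)) : shiftFst (0 : Fin n) i = i := by
  induction i using Fin.lastCases with
  | last => simp
  | cast i => simp

lemma shift_shift (k ℓ : Fin n) (x : Fin (n + 1) × Fin n) :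
    shift k (shift ℓ x) = shift (ℓ + k) x := by
  simp [shift, shiftFst_shiftFst, add_assoc]

lemma shift_zero (x : Fin (n + 1) × Fin n) : shift (0 : Fin n) x = x := by
  simp [shift, shiftFst_zero]

@[simp]
lemma shift_neg_shift (ℓ : Fin n) (x : Fin (n + 1) × Fin n) : shift (-ℓ) (shift ℓ x) = x := by
  rw [shift_shift, add_neg_cancel, shift_zero]

@[simp]
lemma shift_shift_neg (ℓ : Fin n) (x : Fin (n + 1) × Fin n) : shift ℓ (shift (-ℓ) x) = x := by
  rw [shift_shift, neg_add_cancel, shift_zero]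

@[simp]
lemma shiftFst_neg_shiftFst (ℓ : Fin n) (i : Fin (n + 1)) : shiftFst (-ℓ) (shiftFst ℓ i) = i := by
  rw [shiftFst_shiftFst, add_neg_cancel, shiftFst_zero]

@[simp]
lemma shiftFst_shiftFst_neg (ℓ : Fin n) (i : Fin (n + 1)) : shiftFst ℓ (shiftFst (-ℓ) i) = i := by
  rw [shiftFst_shiftFst, neg_add_cancel, shiftFst_zero]

/-- The cyclic shift of the first labels as a permutation. -/
def shiftFstEquiv (ℓ : Fin n) : Equiv.Perm (Fin (n + 1)) :=
  ⟨shiftFst ℓ, shiftFst (-ℓ), shiftFst_neg_shiftFst ℓ, shiftFst_shiftFst_neg ℓ⟩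

lemma mem_image_shift {ℓ : Fin n} {s : Finset (Fin (n + 1) × Fin n)} {x : Fin (n + 1) × Fin n} :
    x ∈ s.image (shift ℓ) ↔ shift (-ℓ) x ∈ s := by
  rw [Finset.mem_image]
  constructor
  · rintro ⟨y, hy, rfl⟩
    rwa [shift_neg_shift]
  · exact fun h => ⟨_, h, shift_shift_neg ℓ x⟩

lemma image_shift_image_shift (k ℓ : Fin n) (s : Finset (Fin (n + 1) × Fin n)) :
    (s.image (shift ℓ)).image (shift k) = s.image (shift (ℓ + k)) := by
  rw [Finset.image_image]
  exact Finset.image_congr fun x _ => shift_shift k ℓ x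

lemma IsMatching.image_shift {M : Finset (Fin (n + 1) × Fin n)} (hM : IsMatching M) (ℓ : Fin n) :
    IsMatching (M.image (shift ℓ)) := by
  intro p hp q hq hpq
  rw [mem_image_shift] at hp hq
  have := hM _ hp _ hq (hpq.imp (congrArg (shiftFst (-ℓ))) (congrArg (· + -ℓ)))
  rw [← shift_shift_neg ℓ p, this, shift_shift_neg]

lemma IsPlanOn.image_shift {s : Finset (Fin (n + 1) × Fin n)} {y : Fin (n + 1) → ℝ}
    {z : Fin n → ℝ} {w : Fin (n + 1) × Fin n → ℝ} {ℓ : Fin n}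
    (hw : IsPlanOn s (fun i => y (shiftFst ℓ i)) (fun j => z (j + ℓ)) w) :
    IsPlanOn (s.image (shift ℓ)) y z fun x => w (shift (-ℓ) x) := by
  refine ⟨fun x => hw.nonneg _, fun x hx => hw.supp _ fun h => hx (mem_image_shift.2 h),
    fun i => ?_, fun j => ?_⟩
  · have := hw.fst (shiftFst (-ℓ) i)
    rw [shiftFst_shiftFst_neg] at this
    rw [← this]
    exact Equiv.sum_comp (Equiv.addRight (-ℓ)) fun j => w (shiftFst (-ℓ) i, j)
  · have := hw.snd (j + -ℓ)
    rw [neg_add_cancel_right] at this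
    rw [← this]
    exact Equiv.sum_comp (shiftFstEquiv (-ℓ)) fun i => w (i, j + -ℓ)

lemma IsSolvable.image_shift {s : Finset (Fin (n + 1) × Fin n)} (hs : IsSolvable s) (ℓ : Fin n) :
    IsSolvable (s.image (shift ℓ)) := by
  intro g
  obtain ⟨u, v, huv⟩ := hs fun x => g (shift ℓ x)
  refine ⟨fun i => u (shiftFst (-ℓ) i), fun j => v (j + -ℓ), fun x hx => ?_⟩
  have := huv _ (mem_image_shift.1 hx)
  rwa [shift_shift_neg] at this

lemma dyckHeight_shift (c : ℝ) (ℓ : Fin n) (i : Fin (n + 1)) (j : Fin n) :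
    dyckHeight n c (shiftFst ℓ i) (j + ℓ) = dyckHeight n c i j := by
  induction i using Fin.lastCases with
  | last => simp [dyckHeight_last]
  | cast i => simp [dyckHeight_castSucc]

lemma IsTightOn.image_shift {c : ℝ} {s : Finset (Fin (n + 1) × Fin n)} {u : Fin (n + 1) → ℝ}
    {v : Fin n → ℝ} (hs : IsTightOn (dyckHeight n c) s u v) (ℓ : Fin n) :
    IsTightOn (dyckHeight n c) (s.image (shift ℓ)) (fun i => u (shiftFst (-ℓ) i))
      (fun j => v (j + -ℓ)) := by
  intro i j
  have := hs (shiftFst (-ℓ) i) (j + -ℓ)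
  rw [dyckHeight_shift] at this
  rwa [mem_image_shift]

/-- The cycle lemma: a cyclic sequence with nonpositive sum can be rotated so that all its suffix
sums are nonpositive. -/
lemma exists_rotation_suffix_nonpos (d : Fin n → ℝ) (hd : ∑ i, d i ≤ 0) :
    ∃ ℓ : Fin n, ∀ r : ℕ, ∑ i : Fin n with r ≤ i.val, d (i + ℓ) ≤ 0 := by
  set D : ℕ → ℝ := fun k => ∑ i ∈ Finset.range k, d (Fin.ofNat n i) with hD
  have hDn : D n ≤ 0 := by
    simp only [hD]
    rw [← Fin.sum_univ_eq_sum_range (fun i => d (Fin.ofNat n i)) n]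
    simpa using hd
  have hper : ∀ k, D (n + k) = D n + D k := by
    intro k
    simp only [hD]
    rw [Finset.sum_range_add]
    congr 1
    refine Finset.sum_congr rfl fun i _ => congrArg d (Fin.ext ?_)
    simp [Fin.ofNat]
  -- The rotation starts where the partial sum `D` is minimal. The suffix sum from `r` is `D n + D ℓ
  -- - D (r + ℓ)`, with `D n ≤ 0`; if `r + ℓ = n + a`, it becomes `D ℓ - D a`.
  obtain ⟨ℓ, -, hℓ⟩ := Finset.exists_min_image Finset.univ (fun ℓ : Fin n => D ℓ.val)
    Finset.univ_nonempty
  refine ⟨ℓ, fun r => ?_⟩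
  have e : ∑ i : Fin n with r ≤ i.val, d (i + ℓ) =
      ∑ i ∈ Finset.Ico r n, d (Fin.ofNat n (i + ℓ.val)) := by
    have e1 : Finset.Ico r n = (Finset.range n).filter (r ≤ ·) := by
      ext k
      simp [and_comm]
    rw [e1, Finset.sum_filter, Finset.sum_filter,
      ← Fin.sum_univ_eq_sum_range (fun k => if r ≤ k then d (Fin.ofNat n (k + ℓ.val)) else 0) n]
    refine Finset.sum_congr rfl fun i _ => ?_
    congr 2
  rw [e]
  rcases le_or_gt n r with hr | hr
  · simp [Finset.Ico_eq_empty_of_le hr]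
  rw [Finset.sum_Ico_add' (fun k => d (Fin.ofNat n k)), Finset.sum_Ico_eq_sub _ (by omega)]
  change D (n + ℓ.val) - D (r + ℓ.val) ≤ 0
  rw [hper]
  rcases lt_or_ge (r + ℓ.val) n with h | h
  · have := hℓ ⟨r + ℓ.val, h⟩ (Finset.mem_univ _)
    dsimp only at this
    linarith
  · obtain ⟨a, ha⟩ := Nat.exists_eq_add_of_le h
    have := hℓ ⟨a, by omega⟩ (Finset.mem_univ _)
    dsimp only at this
    rw [ha, hper]
    linarith

/-! ### The extended Dyck path triangulation -/

lemma mem_extDyckTriangulation {t : Finset (Fin (n + 1) × Fin n)} :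
    t ∈ extDyckTriangulation n ↔ ∃ (ℓ : Fin n) (s : Finset (Fin (n + 1) × Fin n)),
      PathTail 0 0 s ∧ t = s.image (shift ℓ) := by
  simp_rw [extDyckTriangulation, Set.mem_ofPred_eq, isExtDyckPath_iff (NeZero.ne n)]

theorem isTightFamily_extDyckTriangulation {c : ℝ} (hc : 1 < c) :
    IsTightFamily (extDyckTriangulation n) (dyckHeight n c) where
  nonempty t ht := by
    obtain ⟨ℓ, s, hs, rfl⟩ := mem_extDyckTriangulation.1 ht
    exact ⟨_, Finset.mem_image_of_mem _ (hs.mem_start 0 0 rfl rfl)⟩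
  cover y z hy hz hyz := by
    -- The surpluses of the ordinary labels sum to minus the supply of the last column, so the cycle
    -- lemma applies.
    obtain ⟨ℓ, hℓ⟩ := exists_rotation_suffix_nonpos (fun i => y i.castSucc - z i) (by
      rw [Fin.sum_univ_castSucc] at hyz
      rw [Finset.sum_sub_distrib]
      linarith [hy (Fin.last n)])
    have hfeas : FeasibleFrom 0 0 (fun i => y (shiftFst ℓ i)) (fun j => z (j + ℓ)) := by
      refine ⟨fun i => hy _, fun j => hz _, ?_, by simp, by simp, fun r _ => ?_⟩
      · exact (Equiv.sum_comp (shiftFstEquiv ℓ) y).trans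
          (hyz.trans (Equiv.sum_comp (Equiv.addRight ℓ) z).symm)
      · simpa using hℓ r
    obtain ⟨s, hs, w, hw⟩ := FeasibleFrom.exists_plan _ 0 0 _ _ le_rfl
      (Or.inl (Nat.pos_of_ne_zero (NeZero.ne n))) le_rfl hfeas
    exact ⟨_, mem_extDyckTriangulation.2 ⟨ℓ, s, hs, rfl⟩, _, hw.image_shift⟩
  tight t ht := by
    obtain ⟨ℓ, s, hs, rfl⟩ := mem_extDyckTriangulation.1 ht
    obtain ⟨u, v, huv⟩ := hs.isTightOn hc
    exact ⟨_, _, huv.image_shift ℓ⟩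
  solvable t ht := by
    obtain ⟨ℓ, s, hs, rfl⟩ := mem_extDyckTriangulation.1 ht
    refine IsSolvable.image_shift (fun g => ?_) ℓ
    obtain ⟨u, v, -, huv⟩ := hs.solvable g
    exact ⟨fun i => u i, fun j => v j, huv⟩
  spanning t ht u v huv i j := by
    obtain ⟨ℓ, s, hs, rfl⟩ := mem_extDyckTriangulation.1 ht
    obtain ⟨h1, h2⟩ := hs.spanning (u := fun i => u (shiftFst ℓ i)) (v := fun j => v (j + ℓ))
      fun x hx => huv (shift ℓ x) (Finset.mem_image_of_mem _ hx)
    have e1 := h1 (shiftFst (-ℓ) i) (Nat.zero_le _)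
    have e2 := h2 (j + -ℓ) (Nat.zero_le _)
    simp only [shiftFst_shiftFst_neg, neg_add_cancel_right] at e1 e2
    linarith

/-! ### The matchings of the triangulation -/

/-- Away from the last column the matching is already increasing and non-crossing. It has at most
one edge `(n, b)` there, and rotating row `b` to the top makes that edge non-crossing too. No other
edge is broken by the cut, since `PathTail.block` forbids edges from columns up to `b` to rows
beyond `b`. -/
lemma PathTail.exists_shift_isNonCrossingIncreasing {s M : Finset (Fin (n + 1) × Fin n)}
    (hs : PathTail 0 0 s) (hM : IsMatching M) (hMs : M ⊆ s) :
    ∃ k : Fin n, IsNonCrossingIncreasing (M.image (shift k)) := by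
  have hinc : ∀ x ∈ M, x.1 ≠ Fin.last n → x.1.val ≤ x.2.val := fun x hx => hs.fst_le_snd (hMs hx)
  have hnc : ∀ x ∈ M, ∀ y ∈ M, y.1 ≠ Fin.last n → x.1 < y.1 → x.2 < y.2 := by
    intro x hx y hy hl hxy
    refine lt_of_le_of_ne (hs.snd_le_snd (hMs hx) (hMs hy) hl hxy) fun h => hxy.ne ?_
    rw [hM x hx y hy (Or.inr h)]
  by_cases hlast : ∃ b, (Fin.last n, b) ∈ M
  · obtain ⟨b, hb⟩ := hlast
    have hblock : ∀ i j : Fin n, (i.castSucc, j) ∈ M → i ≤ b → j ≤ b := fun i j h hi =>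
      hs.block (hMs hb) (hMs h) hi
    set k : Fin n := ⟨n - 1 - b.val, by have := b.isLt; omega⟩ with hk
    have hle : ∀ j : Fin n, j ≤ b → (j + k).val = j.val + (n - 1 - b.val) := by
      intro j hj
      rw [Fin.le_def] at hj
      rw [Fin.val_add, Nat.mod_eq_of_lt]
      dsimp only [k]
      omega
    have hgt : ∀ j : Fin n, b < j → (j + k).val = j.val - 1 - b.val := by
      intro j hj
      rw [Fin.lt_def] at hj
      have e : j.val + k.val = (j.val - 1 - b.val) + n := by
        dsimp only [k]
        omega
      rw [Fin.val_add, e, Nat.add_mod_right, Nat.mod_eq_of_lt (by omega)]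
    refine ⟨k, ?_, ?_⟩
    · intro x hx₀ y hy₀ hxy
      obtain ⟨⟨i, j⟩, hx, rfl⟩ := Finset.mem_image.1 hx₀
      obtain ⟨⟨i', j'⟩, hy, rfl⟩ := Finset.mem_image.1 hy₀
      clear hx₀ hy₀
      simp only [shift] at hxy ⊢
      rw [Fin.lt_def] at hxy ⊢
      induction i using Fin.lastCases with
      | last =>
        rw [shiftFst_last] at hxy
        exact absurd (shiftFst k i').isLt (by simp only [Fin.val_last] at hxy; omega)
      | cast i =>
        have hij : i ≤ j := hinc (i.castSucc, j) hx (Fin.castSucc_ne_last i)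
        have hb1 := hblock i j hx
        induction i' using Fin.lastCases with
        | last =>
          obtain rfl : j' = b := congrArg Prod.snd (hM _ hy _ hb (Or.inl rfl))
          have hne : j ≠ j' := fun h =>
            Fin.castSucc_ne_last i (congrArg Prod.fst (hM _ hx _ hy (Or.inr h)))
          rw [hle j' le_rfl]
          rcases lt_or_gt_of_ne hne with h | h
          · rw [hle j h.le]
            rw [Fin.lt_def] at h
            omega
          · rw [hgt j h]
            rw [Fin.lt_def] at h
            omega
        | cast i' =>
          have hij' : i' ≤ j' := hinc (i'.castSucc, j') hy (Fin.castSucc_ne_last i')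
          have hb2 := hblock i' j' hy
          have hlt : i < i' → j < j' := fun h => hnc _ hx _ hy (Fin.castSucc_ne_last i')
            (Fin.castSucc_lt_castSucc_iff.2 h)
          simp only [shiftFst_castSucc, Fin.val_castSucc] at hxy
          rcases le_or_gt i b with h1 | h1 <;> rcases le_or_gt i' b with h2 | h2
          · rw [hle i h1, hle i' h2] at hxy
            have := hlt (by rw [Fin.lt_def]; omega)
            rw [hle j (hb1 h1), hle j' (hb2 h2)]
            rw [Fin.lt_def] at this
            omega
          · rw [hle i h1, hgt i' h2] at hxy
            omega
          · rw [hgt j (h1.trans_le hij), hle j' (hb2 h2)]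
            have := h1.trans_le hij
            rw [Fin.lt_def] at this
            omega
          · rw [hgt i h1, hgt i' h2] at hxy
            have := hlt (by rw [Fin.lt_def]; omega)
            rw [hgt j (h1.trans_le hij), hgt j' (h2.trans_le hij')]
            have := h1.trans_le hij
            simp only [Fin.lt_def] at *
            omega
    · intro x hx₀ hxl
      obtain ⟨⟨i, j⟩, hx, rfl⟩ := Finset.mem_image.1 hx₀
      clear hx₀
      simp only [shift] at hxl ⊢
      induction i using Fin.lastCases with
      | last => simp at hxl
      | cast i =>
        have hij : i ≤ j := hinc (i.castSucc, j) hx (Fin.castSucc_ne_last i)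
        simp only [shiftFst_castSucc, Fin.val_castSucc]
        rcases le_or_gt i b with h1 | h1
        · rw [hle i h1, hle j (hblock i j hx h1)]
          rw [Fin.le_def] at hij
          omega
        · rw [hgt i h1, hgt j (h1.trans_le hij)]
          rw [Fin.le_def] at hij
          omega
  · refine ⟨0, ?_⟩
    have e : M.image (shift 0) = M := by
      rw [Finset.image_congr fun x _ => shift_zero x, Finset.image_id']
    rw [e]
    refine ⟨fun x hx y hy => hnc x hx y hy fun h => hlast ⟨y.2, ?_⟩, hinc⟩
    rwa [← h]

theorem matchingsOf_extDyckTriangulation :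
    matchingsOf (extDyckTriangulation n) = extDyckMatchings n := by
  ext M
  constructor
  · rintro ⟨hM0, hM, t, ht, hMt⟩
    obtain ⟨ℓ, s, hs, rfl⟩ := mem_extDyckTriangulation.1 ht
    obtain ⟨k, hk⟩ := hs.exists_shift_isNonCrossingIncreasing (hM.image_shift (-ℓ)) fun x hx => by
      rw [mem_image_shift, neg_neg] at hx
      have := mem_image_shift.1 (hMt hx)
      rwa [shift_neg_shift] at this
    rw [image_shift_image_shift] at hk
    refine ⟨-(-ℓ + k), _, hM0.image _, hM.image_shift _, hk, ?_⟩
    rw [image_shift_image_shift, add_neg_cancel,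
      Finset.image_congr fun x _ => shift_zero x, Finset.image_id']
  · rintro ⟨ℓ, M, hM0, hM, hnc, rfl⟩
    obtain ⟨s, hs, hMs⟩ := PathTail.exists_of_nonCrossing (fun x hx y hy h => (hnc.1 x hx y hy h).le)
      hnc.2 _ 0 0 le_rfl (Or.inl (Nat.pos_of_ne_zero (NeZero.ne n))) le_rfl
    exact ⟨hM0.image _, hM.image_shift ℓ, _, mem_extDyckTriangulation.2 ⟨ℓ, s, hs, rfl⟩,
      Finset.image_subset_image fun x hx => hMs x hx (Nat.zero_le _) (Nat.zero_le _)⟩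

end DyckTri

theorem theorem4p2 (n : ℕ) [NeZero n] :
    DyckTri.IsRegularTriangulation (DyckTri.extDyckTriangulation n) ∧
    DyckTri.IsMatchingEnsemble (DyckTri.extDyckMatchings n) ∧
    DyckTri.matchingsOf (DyckTri.extDyckTriangulation n) = DyckTri.extDyckMatchings n ∧
    ∃ c₀ : ℝ, 1 ≤ c₀ ∧ ∀ c : ℝ, c₀ < c →
      DyckTri.IsInducedBy (DyckTri.extDyckTriangulation n) (DyckTri.dyckHeight n c) := by
  -- Any base above `1` would do for the parts not involving `c`.
  have h2 := DyckTri.isTightFamily_extDyckTriangulation (n := n) one_lt_two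
  refine ⟨⟨h2.isTriangulation, _, h2.isInducedBy⟩, ?_, DyckTri.matchingsOf_extDyckTriangulation,
    1, le_rfl, fun c hc => (DyckTri.isTightFamily_extDyckTriangulation hc).isInducedBy⟩
  rw [← DyckTri.matchingsOf_extDyckTriangulation]
  exact h2.isMatchingEnsemble
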